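/- Let $n\ge 1$, $T>0$, $\kappa>0$, $\gamma>1$, let $\mathbb T^n=\mathbb R^n/\mathbb Z^n$ and let $G\in L^\infty([0,T];L^2(\mathbb T^n;\mathbb R^n))$. Consider the isentropic Euler system $$\partial_t h+\operatorname{div}(hu)=0,\qquad \partial_t(hu)+\operatorname{div}(hu\otimes u)+\nabla(\kappa h^\gamma)=hG \tag{E}$$ on $[0,T]\times\mathbb T^n$. **Measure-valued solutions.** Let $\mathbb S^+=\{(\beta_1,\beta')\in\mathbb R^+\times\mathbb R^n:\ \beta_1^{2\gamma}+|\beta'|^4=1\}$, where $\mathbb R^+=[0,\infty)$. A generalised Young measure is a triple $(\nu,m,\nu^\infty)$, where $\nu=(\nu_{t,x})$ is a weakly* measurable family of probability measures on $\mathbb R^+\times\mathbb R^n$ (defined for a.e. $(t,x)\in[0,T]\times\mathbb T^n$), $m$ is a finite nonnegative measure on $[0,T]\times\mathbb T^n$, and $\nu^\infty=(\nu^\infty_{t,x})$ is a weakly* ($m$-)measurable family of probability measures on $\mathbb S^+$ (defined for $m$-a.e. $(t,x)$). Write $\langle\cdot,\nu\rangle$, $\langle\cdot,\nu^\infty\rangle$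 for integration in $(\lambda_1,\lambda')\in\mathbb R^+\times\mathbb R^n$ and in $(\beta_1,\beta')\in\mathbb S^+$, and put $$\bar h=\langle\lambda_1,\nu\rangle,\quad \overline{hu}=\langle\sqrt{\lambda_1}\,\lambda',\nu\rangle,\quad \overline{hG}=\langle\lambda_1 G,\nu\rangle,\quad \overline{hG\cdot u}=\langle\sqrt{\lambda_1}\,\lambda'\cdot G,\nu\rangle,$$ $$\overline{hu\otimes u}=\langle\lambda'\otimes\lambda',\nu\rangle\,dt\,dx+\langle\beta'\otimes\beta',\nu^\infty\rangle\, m,\quad \overline{h|u|^2}=\langle|\lambda'|^2,\nu\rangle\,dt\,dx+\langle|\beta'|^2,\nu^\infty\rangle\, m,\quad \overline{h^\gamma}=\langle\lambda_1^\gamma,\nu\rangle\,dt\,dx+\langle\beta_1^\gamma,\nu^\infty\rangle\, m.$$ The triple is a measure-valued solution of (E) with initial data $(h_0,u_0)$ if $h_0$, $h_0u_0$ and the moments $\langle\lambda_1,\nu\rangle$, $\langle\sqrt{\lambda_1}\lambda',\nu\rangle$, $\langle\lambda'\otimes\lambda',\nu\rangle$, $\langle\lambda_1^\gamma,\nu\rangle$,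 $\langle\lambda_1G,\nu\rangle$ exist and are integrable, and if for all $\psi\in C^1([0,T]\times\mathbb T^n;\mathbb R)$ and $\phi\in C^1([0,T]\times\mathbb T^n;\mathbb R^n)$ and for a.e. $\tau\in[0,T]$ $$\int_0^\tau\!\!\int_{\mathbb T^n}\partial_t\psi\,\bar h+\nabla\psi\cdot\overline{hu}\,dx\,dt+\int_{\mathbb T^n}\psi(0,x)h_0(x)-\psi(\tau,x)\bar h(\tau,x)\,dx=0,$$ $$\int_{[0,\tau]\times\mathbb T^n}\Bigl(\partial_t\phi\cdot\overline{hu}+\nabla\phi:\overline{hu\otimes u}+\kappa\operatorname{div}\phi\;\overline{h^\gamma}+\phi\cdot\overline{hG}\Bigr)+\int_{\mathbb T^n}\phi(0,x)\cdot h_0u_0(x)-\phi(\tau,x)\cdot\overline{hu}(\tau,x)\,dx=0,$$ where the terms without concentration part are integrated against $dt\,dx$. It is admissible if $\overline{hG\cdot u}$ exists and is integrable on $[0,T]\times\mathbb T^n$ and $$E_{mvs}(t)\le E_0+\int_0^t\!\int_{\mathbb T^n}\overline{hG\cdot u}\,dx\,ds\quad\text{in the sense of distributions on }[0,T],$$ where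 $E_{mvs}$, a measure on $[0,T]$, is the time marginal of $\tfrac12\overline{h|u|^2}+\tfrac{\kappa}{\gamma-1}\overline{h^\gamma}$ and $E_0=\int_{\mathbb T^n}\tfrac12h_0|u_0|^2+\tfrac{\kappa}{\gamma-1}h_0^\gamma\,dx$; that is, for every $0\le\chi\in C_c^\infty(\mathbb R)$, $$\int_{[0,T]}\chi\,dE_{mvs}\le\int_0^T\chi(t)\Bigl(E_0+\int_0^t\!\int_{\mathbb T^n}\overline{hG\cdot u}\,dx\,ds\Bigr)dt .$$ **Theorem.** Let $c>0$ and let $h_0\ge c$ a.e., $h_0\in L^\gamma(\mathbb T^n)$, $h_0|u_0|^2\in L^1(\mathbb T^n)$. Let $H$ be Lipschitz continuous on $[0,T]\times\mathbb T^n$ with $H\ge c$ everywhere, let $U\in C^1([0,T]\times\mathbb T^n;\mathbb R^n)$, and suppose that $(H,U)$ satisfies (E) a.e. in $[0,T]\times\mathbb T^n$ and $(H,U)(0,\cdot)=(h_0,u_0)$ a.e. If $(\nu,m,\nu^\infty)$ is an admissible measure-valued solution of (E) with the same initial data $(h_0,u_0)$, then $$\nu_{t,x}=\delta_{(H(t,x),\sqrt{H(t,x)}\,U(t,x))}\quad\text{for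 a.e. }(t,x)\in[0,T]\times\mathbb T^n,\qquad\text{and}\qquad m=0.$$ -/

import Mathlib

open MeasureTheory Set
open scoped NNReal ENNReal ContDiff

noncomputable section

namespace EulerMV

/-- The flat torus `ℝⁿ / ℤⁿ`; its `volume` is Lebesgue measure, of total mass one. -/
abbrev Torus (n : ℕ) : Type := UnitAddTorus (Fin n)

/-- `ℝⁿ` with the Euclidean norm. -/
abbrev Vec (n : ℕ) : Type := EuclideanSpace ℝ (Fin n)

/-- The state space `ℝ⁺ × ℝⁿ`; a state `(l₁, l')` stands for `(h, √h u)`. -/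
abbrev State (n : ℕ) : Type := ℝ≥0 × Vec n

/-- The space-time domain `[0, T] × 𝕋ⁿ`, inside `ℝ × 𝕋ⁿ`. -/
def slab (n : ℕ) (T : ℝ) : Set (ℝ × Torus n) := Icc 0 T ×ˢ univ

variable {n : ℕ} {F : Type*} [NormedAddCommGroup F] [NormedSpace ℝ F]

/-- `f ∈ C¹([0, T] × 𝕋ⁿ)`: the periodic lift of `f` is `C¹` on `[0, T] × ℝⁿ`.
Values of `f` at times outside `[0, T]` are irrelevant. -/
def IsC1 (T : ℝ) (f : ℝ × Torus n → F) : Prop :=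
  ContDiffOn ℝ 1
    (fun p : ℝ × (Fin n → ℝ) => f (p.1, fun i => (p.2 i : UnitAddCircle)))
    (Icc 0 T ×ˢ univ)

/-- The time derivative on `[0, T] × 𝕋ⁿ` (one-sided at the two end points). -/
def timeDeriv (T : ℝ) (f : ℝ × Torus n → F) (z : ℝ × Torus n) : F :=
  derivWithin (fun s : ℝ => f (s, z.2)) (Icc 0 T) z.1

/-- The partial derivative in the `i`-th spatial direction. -/
def spaceDeriv (i : Fin n) (f : ℝ × Torus n → F) (z : ℝ × Torus n) : F :=
  deriv (fun s : ℝ => f (z.1, z.2 + Pi.single i (s : UnitAddCircle))) 0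

/-- `G ∈ L^∞([0, T]; L²(𝕋ⁿ; ℝⁿ))`. -/
def IsLinftyL2 (T : ℝ) (G : ℝ × Torus n → Vec n) : Prop :=
  AEStronglyMeasurable G (volume.restrict (slab n T)) ∧
    ∃ C : ℝ≥0, ∀ᵐ t ∂(volume.restrict (Icc (0 : ℝ) T)),
      eLpNorm (fun x : Torus n => G (t, x)) 2 volume ≤ C

/-- `(H, U)`, with `H` Lipschitz continuous and `U` of class `C¹` on `[0, T] × 𝕋ⁿ`, solves
`∂ₜ H + div (H U) = 0`, `∂ₜ (H U) + div (H U ⊗ U) + ∇ (κ H ^ γ) = H G`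
almost everywhere in `[0, T] × 𝕋ⁿ`, with initial data `(h₀, u₀)`. -/
structure IsStrongSolution (T κ γ : ℝ) (G : ℝ × Torus n → Vec n)
    (h₀ : Torus n → ℝ) (u₀ : Torus n → Vec n)
    (H : ℝ × Torus n → ℝ) (U : ℝ × Torus n → Vec n) : Prop where
  lipschitz : ∃ K : ℝ≥0, LipschitzOnWith K H (slab n T)
  isC1 : IsC1 T U
  mass : ∀ᵐ z ∂(volume.restrict (slab n T)),
    timeDeriv T H z + ∑ j, spaceDeriv j (fun y => H y * U y j) z = 0
  momentum : ∀ᵐ z ∂(volume.restrict (slab n T)), ∀ i : Fin n,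
    timeDeriv T (fun y => H y * U y i) z
        + ∑ j, spaceDeriv j (fun y => H y * U y i * U y j) z
        + spaceDeriv i (fun y => κ * H y ^ γ) z
      = H z * G z i
  initial_height : ∀ᵐ x : Torus n, H (0, x) = h₀ x
  initial_velocity : ∀ᵐ x : Torus n, U (0, x) = u₀ x

/-- The half `𝕊⁺ = {(β₁, β') : |β₁| ^ (2γ) + |β'| ^ 4 = 1, β₁ ≥ 0}` of the nonhomogeneous
unit sphere with exponents `p = γ`, `q = 2`. -/
def SPlus (n : ℕ) (γ : ℝ) : Set (State n) :=
  {b | (b.1 : ℝ) ^ (2 * γ) + ‖b.2‖ ^ 4 = 1}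

/-- Weak* measurability with respect to `μ` of a family of probability measures. -/
def WeakStarMeasurable {Ω X : Type*} [MeasurableSpace Ω] [TopologicalSpace X]
    [MeasurableSpace X] (μ : Measure Ω) (ν : Ω → ProbabilityMeasure X) : Prop :=
  ∀ φ : X → ℝ, Continuous φ → HasCompactSupport φ →
    AEStronglyMeasurable (fun z => ∫ l, φ l ∂(ν z : Measure X)) μ

/-- Generalised Young measures `(ν, m, ν^∞)` on `[0, T] × 𝕋ⁿ`: the oscillation measure `ν`, the
concentration measure `m`, and the concentration-angle measure `ν^∞`. Only the values of `ν` at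
almost every point of `[0, T] × 𝕋ⁿ` and those of `ν^∞` at `m`-almost every point matter. -/
structure GenYoungMeasure (n : ℕ) (γ T : ℝ) where
  ν : ℝ × Torus n → ProbabilityMeasure (State n)
  m : Measure (ℝ × Torus n)
  νInf : ℝ × Torus n → ProbabilityMeasure (SPlus n γ)
  isFiniteMeasure : IsFiniteMeasure m
  concentrated : m (slab n T)ᶜ = 0
  measurable_ν : WeakStarMeasurable (volume.restrict (slab n T)) ν
  measurable_νInf : WeakStarMeasurable m νInf

namespace GenYoungMeasure

variable {γ T : ℝ}

/-- `⟨f, ν_z⟩`. -/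
def osc (Y : GenYoungMeasure n γ T) (f : State n → F) (z : ℝ × Torus n) : F :=
  ∫ l, f l ∂(Y.ν z : Measure (State n))

/-- `⟨f, ν^∞_z⟩`. -/
def conc (Y : GenYoungMeasure n γ T) (f : State n → F) (z : ℝ × Torus n) : F :=
  ∫ b : SPlus n γ, f b ∂(Y.νInf z : Measure (SPlus n γ))

/-- The function `(t, x) ↦ ⟨f (t, x, ·), ν_{t,x}⟩` is well defined almost everywhere
and integrable on `[0, T] × 𝕋ⁿ`. -/
def OscIntegrable (Y : GenYoungMeasure n γ T) (f : ℝ × Torus n → State n → F) : Prop :=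
  (∀ᵐ z ∂(volume.restrict (slab n T)), Integrable (f z) (Y.ν z : Measure (State n))) ∧
    IntegrableOn (fun z => Y.osc (f z) z) (slab n T)

/-- The integral over `A` of `g` against the measure
`⟨f, ν_{t,x}⟩ dt dx + ⟨f, ν^∞_{t,x}⟩ m(dt dx)`. It is used only for `f` satisfying
`f (s² β₁, s ^ γ β') = s ^ (2γ) f (β₁, β')`, which agree with their own recession functions. -/
def pairing (Y : GenYoungMeasure n γ T) (f : State n → ℝ) (g : ℝ × Torus n → ℝ)
    (A : Set (ℝ × Torus n)) : ℝ :=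
  (∫ z in A, g z * Y.osc f z) + ∫ z in A, g z * Y.conc f z ∂Y.m

/-- The mean height, `⟨l₁, ν⟩`. -/
def hBar (Y : GenYoungMeasure n γ T) : ℝ × Torus n → ℝ :=
  Y.osc fun l => (l.1 : ℝ)

/-- The mean momentum, `⟨√l₁ l', ν⟩`; it has no concentration part, as `γ > 1`. -/
def huBar (Y : GenYoungMeasure n γ T) : ℝ × Torus n → Vec n :=
  Y.osc fun l => √(l.1 : ℝ) • l.2

/-- The mean force density, `⟨l₁ G, ν⟩`. -/
def hGBar (Y : GenYoungMeasure n γ T) (G : ℝ × Torus n → Vec n) (z : ℝ × Torus n) : Vec n :=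
  Y.osc (fun l => (l.1 : ℝ) • G z) z

/-- The mean power density of the force, `⟨√l₁ l' · G, ν⟩`. -/
def hGuBar (Y : GenYoungMeasure n γ T) (G : ℝ × Torus n → Vec n) (z : ℝ × Torus n) : ℝ :=
  Y.osc (fun l => inner ℝ (G z) (√(l.1 : ℝ) • l.2)) z

/-- Measure-valued solutions with initial data `(h₀, u₀)`. The first group of fields says that all
the integrals exist, the last two fields are the mass and the momentum equations. -/
structure IsSolution (Y : GenYoungMeasure n γ T) (κ : ℝ) (G : ℝ × Torus n → Vec n)
    (h₀ : Torus n → ℝ) (u₀ : Torus n → Vec n) : Prop where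
  integrable_h₀ : Integrable h₀
  integrable_h₀u₀ : Integrable fun x => h₀ x • u₀ x
  integrable_h : Y.OscIntegrable fun _ l => (l.1 : ℝ)
  integrable_hu : Y.OscIntegrable fun _ l => √(l.1 : ℝ) • l.2
  integrable_huu : ∀ i j : Fin n, Y.OscIntegrable fun _ l => l.2 i * l.2 j
  integrable_pressure : Y.OscIntegrable fun _ l => (l.1 : ℝ) ^ γ
  integrable_hG : Y.OscIntegrable fun z l => (l.1 : ℝ) • G z
  mass : ∀ ψ : ℝ × Torus n → ℝ, IsC1 T ψ → ∀ᵐ τ ∂(volume.restrict (Icc (0 : ℝ) T)),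
    (∫ z in slab n τ, (timeDeriv T ψ z * Y.hBar z + ∑ i, spaceDeriv i ψ z * Y.huBar z i))
      + ∫ x : Torus n, (ψ (0, x) * h₀ x - ψ (τ, x) * Y.hBar (τ, x)) = 0
  momentum : ∀ φ : ℝ × Torus n → Vec n, IsC1 T φ → ∀ᵐ τ ∂(volume.restrict (Icc (0 : ℝ) T)),
    (∫ z in slab n τ, inner ℝ (timeDeriv T φ z) (Y.huBar z))
      + (∑ i, ∑ j, Y.pairing (fun l => l.2 i * l.2 j)
          (spaceDeriv j fun y => φ y i) (slab n τ))
      + κ * Y.pairing (fun l => (l.1 : ℝ) ^ γ)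
          (fun z => ∑ i, spaceDeriv i (fun y => φ y i) z) (slab n τ)
      + (∫ z in slab n τ, inner ℝ (φ z) (Y.hGBar G z))
      + ∫ x : Torus n,
          (inner ℝ (φ (0, x)) (h₀ x • u₀ x) - inner ℝ (φ (τ, x)) (Y.huBar (τ, x))) = 0

end GenYoungMeasure

/-- The energy density `|l'|² / 2 + κ l₁ ^ γ / (γ - 1)`, that is `h |u|² / 2 + κ h ^ γ / (γ - 1)`. -/
def energyDensity (κ γ : ℝ) (l : State n) : ℝ :=
  1 / 2 * ‖l.2‖ ^ 2 + κ / (γ - 1) * (l.1 : ℝ) ^ γ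

/-- The initial energy `E₀`. -/
def initialEnergy (κ γ : ℝ) (h₀ : Torus n → ℝ) (u₀ : Torus n → Vec n) : ℝ :=
  ∫ x : Torus n, (1 / 2 * (h₀ x * ‖u₀ x‖ ^ 2) + κ / (γ - 1) * h₀ x ^ γ)

/-- Admissibility: `E_mvs(t) ≤ E₀ + ∫₀ᵗ ∫ ⟨√l₁ l' · G, ν⟩ dx ds` in the sense of distributions on
`[0, T]`. Here `E_mvs` is the time marginal of the energy measure of `Y`, a measure on `[0, T]`;
the test functions need not vanish at the end points. -/
structure GenYoungMeasure.IsAdmissible {γ T : ℝ} (Y : GenYoungMeasure n γ T) (κ : ℝ)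
    (G : ℝ × Torus n → Vec n) (h₀ : Torus n → ℝ) (u₀ : Torus n → Vec n) : Prop where
  integrable_power : Y.OscIntegrable fun z l => inner ℝ (G z) (√(l.1 : ℝ) • l.2)
  energy_le : ∀ χ : ℝ → ℝ, ContDiff ℝ ∞ χ → HasCompactSupport χ → (∀ t, 0 ≤ χ t) →
    Y.pairing (energyDensity κ γ) (fun z => χ z.1) (slab n T)
      ≤ ∫ t in Icc (0 : ℝ) T,
          χ t * (initialEnergy κ γ h₀ u₀ + ∫ z in slab n t, Y.hGuBar G z)

end EulerMV

end

noncomputable section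

namespace EulerMV

open Filter Topology

/-! The proof is the relative energy method. A state `l = (l₁, l')` is compared with the strong
solution through `1/2 |l' - √l₁ U|² + κ/(γ-1) (l₁^γ - H^γ - γ H^(γ-1) (l₁ - H))`. By strict
convexity of the power this density is nonnegative and vanishes only at `l = (H, √H U)`. Its
recession function is the energy density itself, since `√l₁ U` and the affine terms are of lower
order. The total relative energy of `[0, t] × 𝕋ⁿ` is therefore the mean of the density under `ν`
plus the energy of the concentrations, and the theorem says that it is zero.

Expanding the density gives the energy plus an expression affine in height and momentum
(`relEnergyBar_eq`). The energy is controlled by admissibility. The affine part is computed by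
testing the momentum equation with `U` and the mass equation with `|U|²/2` and with `κγ/(γ-1)
H^(γ-1)`, while `κ H^γ` is handled by the fundamental theorem of calculus and the vanishing integral
of `div (κ H^γ U)`. After the equations for `(H, U)` are inserted, everything linear in the
deviation from the strong solution cancels, the force included (`relFlux_identity`,
`relEnergy_growth_eq`). What is left is contracted with `∇U` and is quadratic in `l' - √l₁ U` or a
multiple of the relative pressure, so bounded velocity gradients give a bound by a constant `C`
times the relative energy (`relFlux_le`, `conc_flux_le`).

Two points need care. First, `H` is only Lipschitz, whereas test functions are `C¹`; mollification
on the cover of the torus extends the mass equation to Lipschitz test functions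
(`mass_of_lipschitz`). Second, the energy is only a measure in time, so no energy at a fixed time is
available. Testing with smooth cut-offs bounds the energy of the whole slab `[0, τ] × 𝕋ⁿ`
(`energy_slab_le`), which yields `F τ ≤ C ∫₀^τ F` for the monotone function `F τ` = relative energy
of that slab. Grönwall's lemma gives `F = 0`. Then `ν` is a Dirac mass almost everywhere, and `m =
0` because the energy density is positive on `𝕊⁺`. -/

/-! ### The covering of the torus, and coordinate derivatives as line derivatives -/

/-- The universal cover of `ℝ × 𝕋ⁿ`. -/
abbrev Cover (n : ℕ) : Type := ℝ × (Fin n → ℝ)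

/-- The covering map `ℝ × ℝⁿ → ℝ × 𝕋ⁿ`. -/
def proj (n : ℕ) (p : Cover n) : ℝ × Torus n := (p.1, fun i => (p.2 i : UnitAddCircle))

/-- The time direction in the cover. -/
def timeVec (n : ℕ) : Cover n := (1, 0)

/-- The `i`-th spatial direction in the cover. -/
def spaceVec {n : ℕ} (i : Fin n) : Cover n := (0, Pi.single i 1)

instance (n : ℕ) : IsProbabilityMeasure (volume : Measure (Torus n)) := by
  constructor
  simp [volume_pi, Measure.pi_univ]

instance (n : ℕ) : (volume : Measure (Cover n)).IsAddHaarMeasure :=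
  inferInstanceAs (Measure.IsAddHaarMeasure ((volume : Measure ℝ).prod volume))

variable {n : ℕ}

theorem isOpenQuotientMap_proj : IsOpenQuotientMap (proj n) := by
  have h : IsOpenQuotientMap (fun x : ℝ => (x : UnitAddCircle)) :=
    QuotientAddGroup.isOpenQuotientMap_mk
  have h2 : IsOpenQuotientMap (fun x : Fin n → ℝ => (fun i => (x i : UnitAddCircle) : Torus n)) :=
    IsOpenQuotientMap.piMap (fun _ => h)
  exact IsOpenQuotientMap.id.prodMap h2

theorem continuous_proj : Continuous (proj n) := isOpenQuotientMap_proj.continuous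

theorem lipschitzWith_proj : LipschitzWith 1 (proj n) := by
  refine LipschitzWith.of_dist_le_mul fun p q => ?_
  simp only [NNReal.coe_one, one_mul, Prod.dist_eq, proj]
  refine max_le_max le_rfl ?_
  refine (dist_pi_le_iff dist_nonneg).2 fun i => ?_
  refine le_trans ?_ (dist_le_pi_dist _ _ i)
  rw [dist_eq_norm, dist_eq_norm, ← AddCircle.coe_sub]
  exact QuotientAddGroup.norm_mk_le_norm

/-- The section of the covering with values in `(0, 1]ⁿ` carries the measure of the torus to
Lebesgue measure on the cube, which is absolutely continuous. Rademacher's theorem and Lebesgue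
differentiation on the cover descend to the torus in this way. -/
theorem ae_of_ae_proj {Q : ℝ × Torus n → Prop} (h : ∀ᵐ p : Cover n, Q (proj n p)) :
    ∀ᵐ z : ℝ × Torus n, Q z := by
  let s : UnitAddCircle → ℝ := fun x => (AddCircle.equivIoc 1 0 x).1
  have hs : MeasurePreserving s volume (volume.restrict (Ioc (0 : ℝ) (0 + 1))) := by
    exact (measurePreserving_subtype_coe (μa := (volume : Measure ℝ))
      (measurableSet_Ioc (a := (0 : ℝ)) (b := 0 + 1))).comp
      (AddCircle.measurePreserving_equivIoc (1 : ℝ) (a := 0))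
  have hs' : MeasurePreserving (fun (x : Torus n) i => s (x i)) volume
      (Measure.pi fun _ : Fin n => volume.restrict (Ioc (0 : ℝ) (0 + 1))) :=
    measurePreserving_pi _ _ fun _ => hs
  have hp := (MeasurePreserving.id (volume : Measure ℝ)).prod hs'
  have h4 : Measure.QuasiMeasurePreserving
      (fun z : ℝ × Torus n => ((z.1, fun i => s (z.2 i)) : Cover n)) volume volume := by
    refine ⟨hp.measurable, ?_⟩
    have := hp.map_eq
    rw [← Measure.restrict_pi_pi] at this
    refine (this.le.absolutelyContinuous).trans ?_
    exact Measure.AbsolutelyContinuous.rfl.prod Measure.restrict_le_self.absolutelyContinuous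
  filter_upwards [h4.ae h] with z hz
  have : proj n (z.1, fun i => s (z.2 i)) = z := by
    simp only [proj]
    refine Prod.ext rfl (funext fun i => ?_)
    exact (AddCircle.equivIoc 1 0).symm_apply_apply (z.2 i)
  rwa [this] at hz

theorem proj_add_smul_timeVec (p : Cover n) (s : ℝ) :
    proj n (p + s • timeVec n) = (p.1 + s, (proj n p).2) := by
  simp [proj, timeVec]

theorem proj_add_smul_spaceVec (p : Cover n) (i : Fin n) (s : ℝ) :
    proj n (p + s • spaceVec i) = (p.1, (proj n p).2 + Pi.single i (s : UnitAddCircle)) := by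
  simp only [proj, spaceVec, Prod.fst_add, Prod.smul_fst, Prod.snd_add,
    Prod.smul_snd, Pi.add_apply, Pi.smul_apply, smul_eq_mul, AddCircle.coe_add]
  refine Prod.ext (by simp) (funext fun j => ?_)
  by_cases h : j = i
  · subst h; simp
  · simp [Pi.single_eq_of_ne h]

variable {F : Type*} [NormedAddCommGroup F] [NormedSpace ℝ F]

theorem spaceDeriv_proj (i : Fin n) (f : ℝ × Torus n → F) (p : Cover n) :
    spaceDeriv i f (proj n p) = lineDeriv ℝ (f ∘ proj n) p (spaceVec i) := by
  simp only [spaceDeriv, lineDeriv, Function.comp_def, proj_add_smul_spaceVec]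
  rfl

theorem lineDeriv_timeVec (f : ℝ × Torus n → F) (p : Cover n) :
    lineDeriv ℝ (f ∘ proj n) p (timeVec n) = deriv (fun s => f (s, (proj n p).2)) p.1 := by
  simp only [lineDeriv, Function.comp_def, proj_add_smul_timeVec]
  rw [deriv_comp_const_add (fun s => f (s, (proj n p).2)), add_zero]

theorem measurableSet_slab (T : ℝ) : MeasurableSet (slab n T) :=
  measurableSet_Icc.prod MeasurableSet.univ

theorem isCompact_slab (T : ℝ) : IsCompact (slab n T) := isCompact_Icc.prod isCompact_univ

theorem volume_restrict_slab (T : ℝ) : (volume : Measure (ℝ × Torus n)).restrict (slab n T)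
    = (volume.restrict (Icc 0 T)).prod volume := by
  rw [slab, Measure.volume_eq_prod, ← Measure.prod_restrict, Measure.restrict_univ]

instance (T : ℝ) : IsFiniteMeasure ((volume : Measure (ℝ × Torus n)).restrict (slab n T)) := by
  rw [volume_restrict_slab]; infer_instance

theorem slab_subset {τ T : ℝ} (h : τ ≤ T) : slab n τ ⊆ slab n T :=
  prod_mono (Icc_subset_Icc_right h) subset_rfl

theorem ae_fst_of_ae {T : ℝ} {Q : ℝ → Prop} (h : ∀ᵐ t ∂(volume.restrict (Icc 0 T)), Q t) :
    ∀ᵐ z ∂(volume : Measure (ℝ × Torus n)).restrict (slab n T), Q z.1 := by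
  rw [volume_restrict_slab]
  exact Measure.quasiMeasurePreserving_fst.ae h

theorem ae_mem_Ioo (T : ℝ) :
    ∀ᵐ t ∂(volume : Measure ℝ).restrict (Icc 0 T), t ∈ Ioo 0 T := by
  rw [← restrict_Ioo_eq_restrict_Icc]
  exact ae_restrict_mem measurableSet_Ioo

theorem timeDeriv_eq_deriv {T : ℝ} (f : ℝ × Torus n → F) {z : ℝ × Torus n} (hz : z.1 ∈ Ioo 0 T) :
    timeDeriv T f z = deriv (fun s => f (s, z.2)) z.1 :=
  derivWithin_of_mem_nhds (Icc_mem_nhds hz.1 hz.2)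

theorem timeDeriv_congr {T : ℝ} {f g : ℝ × Torus n → F} (h : EqOn f g (slab n T))
    {z : ℝ × Torus n} (hz : z ∈ slab n T) : timeDeriv T f z = timeDeriv T g z :=
  derivWithin_congr (fun _ hs => h ⟨hs, mem_univ _⟩) (h hz)

theorem spaceDeriv_congr {T : ℝ} {f g : ℝ × Torus n → F} (h : EqOn f g (slab n T)) (i : Fin n)
    {z : ℝ × Torus n} (hz : z ∈ slab n T) : spaceDeriv i f z = spaceDeriv i g z := by
  unfold spaceDeriv
  congr 1
  exact funext fun s => h ⟨hz.1, mem_univ _⟩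

theorem exists_proj_eq (z : ℝ × Torus n) : ∃ p, proj n p = z := isOpenQuotientMap_proj.surjective z

theorem proj_mem_slab {T : ℝ} {p : Cover n} : proj n p ∈ slab n T ↔ p ∈ Icc 0 T ×ˢ univ := by
  simp [proj, slab]

/-- The covering is an open map and the strip upstairs is the full preimage of the slab, so
neighbourhoods within the strip push forward exactly to neighbourhoods within the slab. -/
theorem continuousOn_slab_of_comp_proj {X : Type*} [TopologicalSpace X] {T : ℝ}
    {f : ℝ × Torus n → X}
    (h : ContinuousOn (f ∘ proj n) (Icc 0 T ×ˢ univ)) : ContinuousOn f (slab n T) := by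
  intro z hz
  obtain ⟨p, rfl⟩ := exists_proj_eq z
  have h1 := h p (proj_mem_slab.1 hz)
  have h2 : 𝓝[slab n T] (proj n p) = map (proj n) (𝓝[Icc 0 T ×ˢ univ] p) := by
    have h3 : (Icc 0 T ×ˢ univ : Set (Cover n)) = proj n ⁻¹' slab n T := by
      ext q; exact proj_mem_slab.symm
    rw [nhdsWithin, nhdsWithin, h3, ← comap_principal, Filter.push_pull,
      isOpenQuotientMap_proj.map_nhds_eq]
  rw [ContinuousWithinAt, h2]
  exact h1

/-! ### `C¹` functions on the slab -/

namespace IsC1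

variable {T : ℝ} {f : ℝ × Torus n → F}

theorem contDiffOn (hf : IsC1 T f) : ContDiffOn ℝ 1 (f ∘ proj n) (Icc 0 T ×ˢ univ) := hf

theorem continuousOn (hf : IsC1 T f) : ContinuousOn f (slab n T) :=
  continuousOn_slab_of_comp_proj hf.contDiffOn.continuousOn

theorem hasFDerivWithinAt (hf : IsC1 T f) {p : Cover n} (hp : proj n p ∈ slab n T) :
    HasFDerivWithinAt (f ∘ proj n) (fderivWithin ℝ (f ∘ proj n) (Icc 0 T ×ˢ univ) p)
      (Icc 0 T ×ˢ univ) p :=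
  (hf.contDiffOn.differentiableOn one_ne_zero p (proj_mem_slab.1 hp)).hasFDerivWithinAt

theorem hasDerivWithinAt_time_aux (hf : IsC1 T f) {p : Cover n} (hp : proj n p ∈ slab n T) :
    HasDerivWithinAt (fun s => f (s, (proj n p).2))
      (fderivWithin ℝ (f ∘ proj n) (Icc 0 T ×ˢ univ) p (timeVec n)) (Icc 0 T) p.1 := by
  have h1 : HasDerivWithinAt (fun s : ℝ => ((s, p.2) : Cover n)) (timeVec n) (Icc 0 T) p.1 :=
    (hasDerivWithinAt_id _ _).prodMk (hasDerivWithinAt_const _ _ _)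
  exact (hf.hasFDerivWithinAt hp).comp_hasDerivWithinAt _ h1 (t := Icc 0 T ×ˢ univ)
    (fun s hs => ⟨hs, mem_univ _⟩)

theorem hasDerivAt_space_aux (hf : IsC1 T f) {p : Cover n} (hp : proj n p ∈ slab n T) (i : Fin n) :
    HasDerivAt (fun s : ℝ => f (p.1, (proj n p).2 + Pi.single i (s : UnitAddCircle)))
      (fderivWithin ℝ (f ∘ proj n) (Icc 0 T ×ˢ univ) p (spaceVec i)) 0 := by
  have h1 : HasDerivAt (fun s : ℝ => p + s • spaceVec i) ((1 : ℝ) • spaceVec i) 0 :=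
    ((hasDerivAt_id (0 : ℝ)).smul_const _).const_add _
  have h0 : p + (0 : ℝ) • spaceVec i = p := by simp
  have h2 := hf.hasFDerivWithinAt hp
  -- The chain rule needs the base point displayed as the value of the line at parameter `0`.
  rw [← h0] at h2
  have h3 := h2.comp_hasDerivWithinAt (s := univ) (t := Icc 0 T ×ˢ univ) 0 h1.hasDerivWithinAt
    (fun s _ => ⟨by simpa [spaceVec] using (proj_mem_slab.1 hp).1, mem_univ _⟩)
  rw [hasDerivWithinAt_univ, h0, one_smul] at h3
  refine h3.congr_of_eventuallyEq (Eventually.of_forall fun s => ?_)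
  simp only [Function.comp, proj_add_smul_spaceVec]

theorem timeDeriv_proj (hT : 0 < T) (hf : IsC1 T f) {p : Cover n} (hp : proj n p ∈ slab n T) :
    timeDeriv T f (proj n p)
      = fderivWithin ℝ (f ∘ proj n) (Icc 0 T ×ˢ univ) p (timeVec n) :=
  (hf.hasDerivWithinAt_time_aux hp).derivWithin (uniqueDiffOn_Icc hT _ hp.1)

theorem spaceDeriv_proj (hf : IsC1 T f) {p : Cover n} (hp : proj n p ∈ slab n T) (i : Fin n) :
    spaceDeriv i f (proj n p)
      = fderivWithin ℝ (f ∘ proj n) (Icc 0 T ×ˢ univ) p (spaceVec i) :=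
  (hf.hasDerivAt_space_aux hp i).deriv

theorem hasDerivWithinAt_time (hT : 0 < T) (hf : IsC1 T f) {z : ℝ × Torus n} (hz : z ∈ slab n T) :
    HasDerivWithinAt (fun s => f (s, z.2)) (timeDeriv T f z) (Icc 0 T) z.1 := by
  obtain ⟨p, rfl⟩ := exists_proj_eq z
  rw [hf.timeDeriv_proj hT hz]
  exact hf.hasDerivWithinAt_time_aux hz

theorem hasDerivAt_space (hf : IsC1 T f) {z : ℝ × Torus n} (hz : z ∈ slab n T) (i : Fin n) :
    HasDerivAt (fun s : ℝ => f (z.1, z.2 + Pi.single i (s : UnitAddCircle)))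
      (spaceDeriv i f z) 0 := by
  obtain ⟨p, rfl⟩ := exists_proj_eq z
  rw [hf.spaceDeriv_proj hz]
  exact hf.hasDerivAt_space_aux hz i

theorem continuousOn_fderivWithin_apply (hT : 0 < T) (hf : IsC1 T f) (v : Cover n) :
    ContinuousOn (fun p => fderivWithin ℝ (f ∘ proj n) (Icc 0 T ×ˢ univ) p v)
      (Icc 0 T ×ˢ univ) :=
  (hf.contDiffOn.continuousOn_fderivWithin
    ((uniqueDiffOn_Icc hT).prod uniqueDiffOn_univ) le_rfl).clm_apply continuousOn_const

theorem continuousOn_timeDeriv (hT : 0 < T) (hf : IsC1 T f) :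
    ContinuousOn (timeDeriv T f) (slab n T) :=
  continuousOn_slab_of_comp_proj <| (hf.continuousOn_fderivWithin_apply hT (timeVec n)).congr
    fun _ hp => hf.timeDeriv_proj hT (proj_mem_slab.2 hp)

theorem continuousOn_spaceDeriv (hT : 0 < T) (hf : IsC1 T f) (i : Fin n) :
    ContinuousOn (spaceDeriv i f) (slab n T) :=
  continuousOn_slab_of_comp_proj <| (hf.continuousOn_fderivWithin_apply hT (spaceVec i)).congr
    fun _ hp => hf.spaceDeriv_proj (proj_mem_slab.2 hp) i

end IsC1

/-! ### Lipschitz functions on the slab -/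

section Lipschitz

variable {T : ℝ} {K : ℝ≥0}

theorem dist_add_single (x : Torus n) (i : Fin n) (s s' : ℝ) :
    dist (x + Pi.single i (s : UnitAddCircle)) (x + Pi.single i (s' : UnitAddCircle))
      ≤ |s - s'| := by
  refine (dist_pi_le_iff (abs_nonneg _)).2 fun j => ?_
  simp only [Pi.add_apply, dist_add_left]
  by_cases h : j = i
  · subst h
    simp only [Pi.single_eq_same]
    rw [dist_eq_norm, ← AddCircle.coe_sub]
    exact QuotientAddGroup.norm_mk_le_norm
  · simp [Pi.single_eq_of_ne h]

theorem lipschitzWith_time {g : ℝ × Torus n → ℝ} (hg : LipschitzWith K g) (x : Torus n) :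
    LipschitzWith K fun s => g (s, x) := by
  have := hg.comp (LipschitzWith.prodMk_right x)
  rwa [mul_one] at this

theorem lipschitzWith_space {g : ℝ × Torus n → ℝ} (hg : LipschitzWith K g) (z : ℝ × Torus n)
    (i : Fin n) :
    LipschitzWith K fun s : ℝ => g (z.1, z.2 + Pi.single i (s : UnitAddCircle)) := by
  refine LipschitzWith.of_dist_le_mul fun s s' => (hg.dist_le_mul _ _).trans ?_
  gcongr
  simp only [Prod.dist_eq, dist_self]
  exact max_le dist_nonneg (dist_add_single _ _ _ _)

/-- Rademacher's theorem in a single direction, applied to the lift and pushed down by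
`ae_of_ae_proj`. -/
theorem ae_differentiableAt_time_of_lipschitzWith {g : ℝ × Torus n → ℝ} (hg : LipschitzWith K g) :
    ∀ᵐ z : ℝ × Torus n, DifferentiableAt ℝ (fun s => g (s, z.2)) z.1 := by
  apply ae_of_ae_proj
  have h := (hg.comp lipschitzWith_proj).ae_lineDifferentiableAt (μ := volume) (timeVec n)
  filter_upwards [h] with p hp
  simp only [LineDifferentiableAt, Function.comp_def, proj_add_smul_timeVec] at hp
  have h2 : (fun s => g (s, (proj n p).2)) = fun s => (fun u => g (p.1 + u, (proj n p).2)) (s - p.1) := by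
    funext s; simp
  rw [h2]
  refine DifferentiableAt.comp (g := fun u => g (p.1 + u, (proj n p).2)) (f := fun s => s - p.1)
    p.1 ?_ (by fun_prop)
  rwa [sub_self]

theorem ae_differentiableAt_space_of_lipschitzWith {g : ℝ × Torus n → ℝ} (hg : LipschitzWith K g)
    (i : Fin n) :
    ∀ᵐ z : ℝ × Torus n,
      DifferentiableAt ℝ (fun s : ℝ => g (z.1, z.2 + Pi.single i (s : UnitAddCircle))) 0 := by
  apply ae_of_ae_proj
  have h := (hg.comp lipschitzWith_proj).ae_lineDifferentiableAt (μ := volume) (spaceVec i)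
  filter_upwards [h] with p hp
  simp only [LineDifferentiableAt, Function.comp_def, proj_add_smul_spaceVec] at hp
  exact hp

variable {f : ℝ × Torus n → ℝ}

theorem ae_differentiableAt_time (hf : LipschitzOnWith K f (slab n T)) :
    ∀ᵐ z ∂(volume.restrict (slab n T)), z.1 ∈ Ioo 0 T ∧
      DifferentiableAt ℝ (fun s => f (s, z.2)) z.1 := by
  -- A global extension with the same Lipschitz constant. At interior times it agrees with `f` on a
  -- whole time interval, so the time derivatives coincide; the two end times form a null set.
  obtain ⟨g, hg, hfg⟩ := hf.extend_real
  filter_upwards [ae_restrict_of_ae (ae_differentiableAt_time_of_lipschitzWith hg),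
    ae_fst_of_ae (ae_mem_Ioo T)] with z hz hz2
  refine ⟨hz2, hz.congr_of_eventuallyEq ?_⟩
  filter_upwards [Icc_mem_nhds hz2.1 hz2.2] with s hs
  exact hfg ⟨hs, mem_univ _⟩

theorem ae_differentiableAt_space (hf : LipschitzOnWith K f (slab n T)) (i : Fin n) :
    ∀ᵐ z ∂(volume.restrict (slab n T)),
      DifferentiableAt ℝ (fun s : ℝ => f (z.1, z.2 + Pi.single i (s : UnitAddCircle))) 0 := by
  obtain ⟨g, hg, hfg⟩ := hf.extend_real
  filter_upwards [ae_restrict_of_ae (ae_differentiableAt_space_of_lipschitzWith hg i),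
    ae_restrict_mem (measurableSet_slab T)] with z hz hz2
  convert hz using 2 with s
  exact hfg ⟨hz2.1, mem_univ _⟩

theorem abs_deriv_le_of_lipschitzWith {u : ℝ → ℝ} (hu : LipschitzWith K u) (s : ℝ) :
    |deriv u s| ≤ K := norm_deriv_le_of_lipschitz hu

theorem ae_abs_timeDeriv_le (hf : LipschitzOnWith K f (slab n T)) :
    ∀ᵐ z ∂(volume.restrict (slab n T)), |timeDeriv T f z| ≤ K := by
  obtain ⟨g, hg, hfg⟩ := hf.extend_real
  filter_upwards [ae_fst_of_ae (ae_mem_Ioo T)] with z hz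
  rw [timeDeriv_congr hfg ⟨Ioo_subset_Icc_self hz, mem_univ _⟩, timeDeriv_eq_deriv g hz]
  exact abs_deriv_le_of_lipschitzWith (lipschitzWith_time hg _) _

theorem abs_spaceDeriv_le (hf : LipschitzOnWith K f (slab n T)) (i : Fin n) {z : ℝ × Torus n}
    (hz : z ∈ slab n T) : |spaceDeriv i f z| ≤ K := by
  obtain ⟨g, hg, hfg⟩ := hf.extend_real
  rw [spaceDeriv_congr hfg i hz]
  exact abs_deriv_le_of_lipschitzWith (lipschitzWith_space hg _ i) _

/-- The derivative of a jointly continuous function in one variable is Borel measurable in all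
variables, wherever it exists or takes its default value `0`. -/
theorem aestronglyMeasurable_timeDeriv (hf : LipschitzOnWith K f (slab n T)) :
    AEStronglyMeasurable (timeDeriv T f) (volume.restrict (slab n T)) := by
  obtain ⟨g, hg, hfg⟩ := hf.extend_real
  have h1 : Measurable fun z : ℝ × Torus n => deriv (fun s => g (s, z.2)) z.1 := by
    have := measurable_deriv_with_param (𝕜 := ℝ) (f := fun (x : Torus n) (s : ℝ) => g (s, x))
      (hg.continuous.comp continuous_swap)
    exact this.comp measurable_swap
  refine h1.aestronglyMeasurable.congr ?_
  filter_upwards [ae_fst_of_ae (ae_mem_Ioo T)] with z hz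
  rw [timeDeriv_congr hfg ⟨Ioo_subset_Icc_self hz, mem_univ _⟩, timeDeriv_eq_deriv g hz]

theorem continuous_add_single (i : Fin n) :
    Continuous fun q : Torus n × ℝ => q.1 + Pi.single i (q.2 : UnitAddCircle) := by
  refine continuous_fst.add ?_
  exact (continuous_single i).comp ((AddCircle.continuous_mk' 1).comp continuous_snd)

theorem aestronglyMeasurable_spaceDeriv (hf : LipschitzOnWith K f (slab n T)) (i : Fin n) :
    AEStronglyMeasurable (spaceDeriv i f) (volume.restrict (slab n T)) := by
  obtain ⟨g, hg, hfg⟩ := hf.extend_real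
  have h1 : Measurable (spaceDeriv i g) := by
    have := measurable_deriv_with_param (𝕜 := ℝ)
      (f := fun (z : ℝ × Torus n) (s : ℝ) => g (z.1, z.2 + Pi.single i (s : UnitAddCircle))) (by
        refine hg.continuous.comp ?_
        exact (continuous_fst.comp continuous_fst).prodMk ((continuous_add_single i).comp
          ((continuous_snd.comp continuous_fst).prodMk continuous_snd)))
    exact this.comp (measurable_id.prodMk measurable_const)
  refine h1.aestronglyMeasurable.congr ?_
  filter_upwards [ae_restrict_mem (measurableSet_slab T)] with z hz
  rw [spaceDeriv_congr hfg i hz]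

/-- The integral of a directional derivative over the torus vanishes. -/
theorem integral_deriv_single_eq_zero {u : Torus n → ℝ} (hu : Continuous u) (C : ℝ) (i : Fin n)
    (hC : ∀ (x : Torus n) (s : ℝ), |u (x + Pi.single i (s : UnitAddCircle)) - u x| ≤ C * |s|)
    (hd : ∀ᵐ x : Torus n, DifferentiableAt ℝ (fun s : ℝ => u (x + Pi.single i (s : UnitAddCircle))) 0) :
    ∫ x : Torus n, deriv (fun s : ℝ => u (x + Pi.single i (s : UnitAddCircle))) 0 = 0 := by
  -- Difference quotients are bounded by `C` and converge almost everywhere to the derivative; each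
  -- has integral zero by translation invariance.
  have h1 : Tendsto (fun s : ℝ => ∫ x : Torus n, s⁻¹ * (u (x + Pi.single i (s : UnitAddCircle)) - u x))
      (𝓝[>] 0) (𝓝 (∫ x : Torus n, deriv (fun s : ℝ => u (x + Pi.single i (s : UnitAddCircle))) 0)) := by
    refine tendsto_integral_filter_of_dominated_convergence (fun _ => C) ?_ ?_ (by simp) ?_
    · refine Eventually.of_forall fun s => Continuous.aestronglyMeasurable ?_
      fun_prop
    · filter_upwards [self_mem_nhdsWithin] with s (hs : 0 < s)
      refine Eventually.of_forall fun x => ?_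
      rw [norm_mul, norm_inv, Real.norm_eq_abs, Real.norm_eq_abs, inv_mul_le_iff₀ (by positivity),
        mul_comm]
      exact hC x s
    · filter_upwards [hd] with x hx
      have := hx.hasDerivAt.tendsto_slope_zero_right
      simpa using this
  refine tendsto_nhds_unique h1 ?_
  have h2 : ∀ s : ℝ, ∫ x : Torus n, s⁻¹ * (u (x + Pi.single i (s : UnitAddCircle)) - u x) = 0 := by
    intro s
    have hi : ∀ v : Torus n → ℝ, Continuous v → Integrable v := fun v hv =>
      hv.integrable_of_hasCompactSupport (HasCompactSupport.of_compactSpace v)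
    rw [integral_const_mul, integral_sub (hi _ (by fun_prop)) (hi _ hu),
      integral_add_right_eq_self (fun x => u x)]
    simp
  simp only [h2]
  exact tendsto_const_nhds

/-- Lipschitz functions are absolutely continuous, so the fundamental theorem of calculus applies;
one-sided derivatives differ from `deriv` only at end points. -/
theorem integral_derivWithin_eq_sub {u : ℝ → ℝ} {τ : ℝ} (hu : LipschitzOnWith K u (Icc 0 T))
    (hτ : τ ∈ Icc 0 T) : ∫ s in Icc 0 τ, derivWithin u (Icc 0 T) s = u τ - u 0 := by
  have h1 : LipschitzOnWith K u (uIcc 0 τ) := by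
    rw [uIcc_of_le hτ.1]; exact hu.mono (Icc_subset_Icc_right hτ.2)
  rw [← h1.absolutelyContinuousOnInterval.integral_deriv_eq_sub,
    intervalIntegral.integral_of_le hτ.1, integral_Icc_eq_integral_Ioc,
    ← integral_Ioc_eq_integral_Ioo.symm, integral_Ioc_eq_integral_Ioo]
  refine setIntegral_congr_fun measurableSet_Ioo fun s hs => ?_
  exact derivWithin_of_mem_nhds (Icc_mem_nhds hs.1 (hs.2.trans_le hτ.2))

end Lipschitz

/-! ### Mollification -/

section Mollify

open Convolution ContinuousLinearMap

/-- The mollification of `g` by a bump function on the cover. -/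
def mollify (φ : ContDiffBump (0 : Cover n)) (g : ℝ × Torus n → ℝ) (z : ℝ × Torus n) : ℝ :=
  ∫ t, φ.normed volume t * g (z - proj n t)

theorem proj_sub (p q : Cover n) : proj n (p - q) = proj n p - proj n q := by
  refine Prod.ext rfl (funext fun i => ?_)
  simp [proj]

variable {K : ℝ≥0} {g : ℝ × Torus n → ℝ}

/-- The covering is a group homomorphism, so averaging over translates on the torus lifts to an
ordinary convolution; smoothness and convergence are read off there. -/
theorem mollify_comp_proj (φ : ContDiffBump (0 : Cover n)) :
    mollify φ g ∘ proj n = (φ.normed volume ⋆[lsmul ℝ ℝ, volume] (g ∘ proj n)) := by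
  funext p
  simp [mollify, MeasureTheory.convolution, proj_sub]

theorem integrable_normed_mul (φ : ContDiffBump (0 : Cover n)) {u : Cover n → ℝ}
    (hu : Continuous u) : Integrable fun t => φ.normed volume t * u t :=
  (φ.continuous_normed.mul hu).integrable_of_hasCompactSupport
    (φ.hasCompactSupport_normed.mul_right)

theorem continuous_sub_proj (hg : Continuous g) (z : ℝ × Torus n) :
    Continuous fun t => g (z - proj n t) :=
  hg.comp (continuous_const.sub continuous_proj)

theorem lipschitzWith_mollify (hg : LipschitzWith K g) (φ : ContDiffBump (0 : Cover n)) :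
    LipschitzWith K (mollify φ g) := by
  refine LipschitzWith.of_dist_le_mul fun z z' => ?_
  rw [Real.dist_eq, mollify, mollify, ← integral_sub
    (integrable_normed_mul φ (continuous_sub_proj hg.continuous z))
    (integrable_normed_mul φ (continuous_sub_proj hg.continuous z'))]
  refine (abs_integral_le_integral_abs).trans ?_
  have h1 : ∫ t, φ.normed volume t * (K * dist z z') = K * dist z z' := by
    rw [integral_mul_const, φ.integral_normed, one_mul]
  rw [← h1]
  refine integral_mono_of_nonneg (Eventually.of_forall fun _ => abs_nonneg _)
    (φ.integrable_normed.mul_const _) (Eventually.of_forall fun t => ?_)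
  simp only
  rw [← mul_sub, abs_mul, abs_of_nonneg (φ.nonneg_normed t)]
  refine mul_le_mul_of_nonneg_left ?_ (φ.nonneg_normed t)
  have := hg.dist_le_mul (z - proj n t) (z' - proj n t)
  rwa [Real.dist_eq, dist_sub_right] at this

theorem isC1_mollify (hg : Continuous g) (φ : ContDiffBump (0 : Cover n)) (T : ℝ) :
    IsC1 T (mollify φ g) := by
  have h : ContDiff ℝ 1 (mollify φ g ∘ proj n) := by
    rw [mollify_comp_proj]
    exact φ.hasCompactSupport_normed.contDiff_convolution_left (n := 1) _ φ.contDiff_normed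
      (hg.comp continuous_proj).locallyIntegrable
  exact h.contDiffOn

theorem abs_mollify_sub_le (hg : LipschitzWith K g) (φ : ContDiffBump (0 : Cover n))
    (z : ℝ × Torus n) : |mollify φ g z - g z| ≤ K * φ.rOut := by
  obtain ⟨p, rfl⟩ := exists_proj_eq z
  have hl : LipschitzWith K (g ∘ proj n) := by simpa using hg.comp lipschitzWith_proj
  have h := φ.dist_normed_convolution_le (μ := volume) (x₀ := p) (g := g ∘ proj n)
    (ε := K * φ.rOut) hl.continuous.aestronglyMeasurable (fun x hx => by
      refine (hl.dist_le_mul _ _).trans ?_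
      gcongr
      exact (Metric.mem_ball.1 hx).le)
  rw [← mollify_comp_proj] at h
  exact h

/-- Differentiation under the integral, dominated through the Lipschitz constant. The derivative is
put on `g` and not on the kernel, so that Lebesgue differentiation gives almost everywhere
convergence of the derivatives. -/
theorem lineDeriv_mollify (hg : LipschitzWith K g) (φ : ContDiffBump (0 : Cover n))
    (p v : Cover n) :
    lineDeriv ℝ (mollify φ g ∘ proj n) p v =
      (φ.normed volume ⋆[lsmul ℝ ℝ, volume] fun q => lineDeriv ℝ (g ∘ proj n) q v) p := by
  have hl : LipschitzWith K (g ∘ proj n) := by simpa using hg.comp lipschitzWith_proj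
  simp only [lineDeriv, Function.comp_def, mollify, MeasureTheory.convolution, lsmul_apply,
    smul_eq_mul, ← proj_sub]
  refine HasDerivAt.deriv ?_
  have hmeas : AEStronglyMeasurable (fun t => φ.normed volume t *
      deriv (fun s : ℝ => g (proj n (p - t + s • v))) 0) volume := by
    refine φ.continuous_normed.aestronglyMeasurable.mul ?_
    exact ((measurable_lineDeriv (𝕜 := ℝ) (v := v) hl.continuous).comp
      (measurable_const.sub measurable_id)).aestronglyMeasurable
  -- The reflection `t ↦ p - t` preserves Lebesgue measure, hence Rademacher's exceptional set stays
  -- null.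
  have hae : ∀ᵐ t : Cover n, LineDifferentiableAt ℝ (g ∘ proj n) (p - t) v :=
    (Measure.measurePreserving_sub_left volume p).quasiMeasurePreserving.ae
      (hl.ae_lineDifferentiableAt (μ := volume) v)
  refine (hasDerivAt_integral_of_dominated_loc_of_lip (s := univ)
    (F := fun (s : ℝ) t => φ.normed volume t * g (proj n (p + s • v - t)))
    (bound := fun t => φ.normed volume t * (K * ‖v‖)) univ_mem ?_ ?_ hmeas ?_ ?_ ?_).2
  · refine Eventually.of_forall fun s => (integrable_normed_mul φ ?_).aestronglyMeasurable
    exact hl.continuous.comp (continuous_const.sub continuous_id)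
  · refine integrable_normed_mul φ ?_
    exact hl.continuous.comp (continuous_const.sub continuous_id)
  · refine Eventually.of_forall fun t => LipschitzWith.lipschitzOnWith ?_
    refine LipschitzWith.of_dist_le_mul fun s s' => ?_
    rw [Real.dist_eq, ← mul_sub, abs_mul, abs_of_nonneg (φ.nonneg_normed t), Real.coe_nnabs,
      abs_of_nonneg (mul_nonneg (φ.nonneg_normed t) (by positivity)), mul_assoc]
    refine mul_le_mul_of_nonneg_left ?_ (φ.nonneg_normed t)
    refine (hl.dist_le_mul _ _).trans_eq ?_
    rw [dist_sub_right, dist_add_left, dist_eq_norm, ← sub_smul, norm_smul, dist_eq_norm]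
    ring
  · exact φ.integrable_normed.mul_const _
  · filter_upwards [hae] with t ht
    have := ht.hasDerivAt.const_mul (φ.normed volume t)
    simp only [Function.comp_apply] at this
    simp only [add_sub_right_comm p]
    exact this

/-- Lipschitz functions on the slab are limits of `C¹` functions with the same Lipschitz bound. -/
theorem exists_isC1_approx {T : ℝ} {f : ℝ × Torus n → ℝ}
    (hf : LipschitzOnWith K f (slab n T)) :
    ∃ ψ : ℕ → ℝ × Torus n → ℝ, (∀ k, IsC1 T (ψ k)) ∧ (∀ k, LipschitzWith K (ψ k)) ∧
      (∀ k, ∀ z ∈ slab n T, |ψ k z - f z| ≤ 2 * K) ∧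
      (∀ z ∈ slab n T, Tendsto (fun k => ψ k z) atTop (𝓝 (f z))) ∧
      (∀ᵐ z ∂(volume.restrict (slab n T)),
        Tendsto (fun k => timeDeriv T (ψ k) z) atTop (𝓝 (timeDeriv T f z))) ∧
      (∀ i, ∀ᵐ z ∂(volume.restrict (slab n T)),
        Tendsto (fun k => spaceDeriv i (ψ k) z) atTop (𝓝 (spaceDeriv i f z))) := by
  obtain ⟨g, hg, hfg⟩ := hf.extend_real
  have hl : LipschitzWith K (g ∘ proj n) := by simpa using hg.comp lipschitzWith_proj
  -- The ratio of outer to inner radius is always `2`: a bounded ratio is what convergence at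
  -- Lebesgue points requires. The outer radius is at most `2`, whence the uniform bound `2 * K`.
  let φ : ℕ → ContDiffBump (0 : Cover n) := fun k =>
    ⟨1 / ((k : ℝ) + 1), 2 * (1 / ((k : ℝ) + 1)), by positivity, by
      have : 0 < 1 / ((k : ℝ) + 1) := by positivity
      linarith⟩
  have hφ : Tendsto (fun k => (φ k).rOut) atTop (𝓝 0) := by
    have := (tendsto_one_div_add_atTop_nhds_zero_nat (𝕜 := ℝ)).const_mul 2
    rwa [mul_zero] at this
  have hconv : ∀ v, ∀ᵐ p : Cover n, Tendsto (fun k => lineDeriv ℝ (mollify (φ k) g ∘ proj n) p v)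
      atTop (𝓝 (lineDeriv ℝ (g ∘ proj n) p v)) := by
    intro v
    simp only [lineDeriv_mollify hg]
    exact ContDiffBump.ae_convolution_tendsto_right_of_locallyIntegrable hφ (K := 2)
      (Eventually.of_forall fun k => le_rfl) (hl.locallyIntegrable_lineDeriv v)
  have hsub : ∀ k z, |mollify (φ k) g z - g z| ≤ K * (φ k).rOut := fun k z =>
    abs_mollify_sub_le hg _ _
  refine ⟨fun k => mollify (φ k) g, fun k => isC1_mollify hg.continuous _ _,
    fun k => lipschitzWith_mollify hg _, fun k z hz => ?_, fun z hz => ?_, ?_, fun i => ?_⟩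
  · rw [hfg hz, mul_comm (2 : ℝ)]
    refine (hsub k z).trans ?_
    gcongr
    have : 1 / ((k : ℝ) + 1) ≤ 1 := by
      rw [div_le_one (by positivity)]; linarith [(k.cast_nonneg : (0 : ℝ) ≤ k)]
    show 2 * (1 / ((k : ℝ) + 1)) ≤ 2
    linarith
  · rw [hfg hz, tendsto_iff_dist_tendsto_zero]
    refine squeeze_zero (fun _ => dist_nonneg) (fun k => hsub k z) ?_
    simpa using hφ.const_mul (K : ℝ)
  · have h1 : ∀ᵐ z : ℝ × Torus n, Tendsto (fun k => deriv (fun s => mollify (φ k) g (s, z.2)) z.1)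
        atTop (𝓝 (deriv (fun s => g (s, z.2)) z.1)) := by
      apply ae_of_ae_proj
      filter_upwards [hconv (timeVec n)] with p hp
      simp only [lineDeriv_timeVec] at hp
      exact hp
    filter_upwards [ae_restrict_of_ae h1, ae_fst_of_ae (ae_mem_Ioo T)] with z hz hz2
    rw [timeDeriv_congr hfg ⟨Ioo_subset_Icc_self hz2, mem_univ _⟩]
    simpa only [timeDeriv_eq_deriv _ hz2] using hz
  · have h1 : ∀ᵐ z : ℝ × Torus n, Tendsto (fun k => spaceDeriv i (mollify (φ k) g) z)
        atTop (𝓝 (spaceDeriv i g z)) := by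
      apply ae_of_ae_proj
      filter_upwards [hconv (spaceVec i)] with p hp
      simpa only [spaceDeriv_proj] using hp
    filter_upwards [ae_restrict_of_ae h1, ae_restrict_mem (measurableSet_slab T)] with z hz hz2
    rwa [spaceDeriv_congr hfg i hz2]

end Mollify

/-! ### Time slices of integrals over the slab -/

theorem ae_integrable_slice {T : ℝ} {F : Type*} [NormedAddCommGroup F] {f : ℝ × Torus n → F}
    (hf : IntegrableOn f (slab n T)) :
    ∀ᵐ t ∂(volume.restrict (Icc (0 : ℝ) T)), Integrable fun x => f (t, x) := by
  rw [IntegrableOn, volume_restrict_slab] at hf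
  exact hf.prod_right_ae

theorem setIntegral_slab {T : ℝ} {f : ℝ × Torus n → F} (hf : IntegrableOn f (slab n T)) :
    ∫ z in slab n T, f z = ∫ t in Icc 0 T, ∫ x, f (t, x) := by
  rw [IntegrableOn, volume_restrict_slab] at hf
  rw [volume_restrict_slab, integral_prod _ hf]

theorem integrableOn_integral_slice {T : ℝ} {f : ℝ × Torus n → F} (hf : IntegrableOn f (slab n T)) :
    IntegrableOn (fun t => ∫ x, f (t, x)) (Icc 0 T) := by
  rw [IntegrableOn, volume_restrict_slab] at hf
  exact hf.integral_prod_left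

theorem integrable_apply {α : Type*} [MeasurableSpace α] {μ : Measure α} {f : α → Vec n}
    (hf : Integrable f μ) (i : Fin n) : Integrable (fun z => f z i) μ :=
  (EuclideanSpace.proj (𝕜 := ℝ) i).integrable_comp hf

/-! ### The mass equation with Lipschitz test functions -/

section MassEquation

variable {T γ : ℝ} {κ : ℝ} {G : ℝ × Torus n → Vec n} {h₀ : Torus n → ℝ} {u₀ : Torus n → Vec n}

namespace GenYoungMeasure

variable {Y : GenYoungMeasure n γ T}

theorem IsSolution.integrableOn_hBar (hY : Y.IsSolution κ G h₀ u₀) :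
    IntegrableOn Y.hBar (slab n T) := hY.integrable_h.2

theorem IsSolution.integrableOn_huBar (hY : Y.IsSolution κ G h₀ u₀) :
    IntegrableOn Y.huBar (slab n T) := hY.integrable_hu.2

/-- The mass equation can be tested with Lipschitz functions. -/
theorem IsSolution.mass_of_lipschitz (hY : Y.IsSolution κ G h₀ u₀) {K : ℝ≥0}
    {f : ℝ × Torus n → ℝ} (hf : LipschitzOnWith K f (slab n T)) :
    ∀ᵐ τ ∂(volume.restrict (Icc (0 : ℝ) T)),
      (∫ z in slab n τ, (timeDeriv T f z * Y.hBar z + ∑ i, spaceDeriv i f z * Y.huBar z i))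
        + ∫ x : Torus n, (f (0, x) * h₀ x - f (τ, x) * Y.hBar (τ, x)) = 0 := by
  obtain ⟨ψ, hC1, hlip, hbd, hlim, htime, hspace⟩ := exists_isC1_approx hf
  -- There are countably many test functions, so one null set of times serves them all.
  have hmass := ae_all_iff.2 fun k => hY.mass (ψ k) (hC1 k)
  obtain ⟨M, hM⟩ : ∃ M, ∀ z ∈ slab n T, |f z| ≤ M :=
    (isCompact_slab T).exists_bound_of_continuousOn hf.continuousOn
  have hbd' : ∀ k, ∀ z ∈ slab n T, |ψ k z| ≤ 2 * K + M := fun k z hz => by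
    have h1 := hbd k z hz
    have h2 := hM z hz
    have h3 := abs_add_le (ψ k z - f z) (f z)
    rw [sub_add_cancel] at h3
    linarith
  filter_upwards [hmass, ae_integrable_slice hY.integrableOn_hBar,
    ae_restrict_mem measurableSet_Icc] with τ hτ hslice hτm
  have hT0 : (0 : ℝ) ∈ Icc 0 T := ⟨le_rfl, hτm.1.trans hτm.2⟩
  have hsub : slab n τ ⊆ slab n T := slab_subset hτm.2
  have hle : (volume : Measure (ℝ × Torus n)).restrict (slab n τ) ≤ volume.restrict (slab n T) :=
    Measure.restrict_mono hsub le_rfl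
  have hhu := hY.integrableOn_huBar.mono_set hsub
  have hh := hY.integrableOn_hBar.mono_set hsub
  -- The mollifications share the Lipschitz constant `K`, so `K` times the absolute moments
  -- dominates.
  have L1 : Tendsto (fun k => ∫ z in slab n τ, (timeDeriv T (ψ k) z * Y.hBar z
      + ∑ i, spaceDeriv i (ψ k) z * Y.huBar z i)) atTop
      (𝓝 (∫ z in slab n τ, (timeDeriv T f z * Y.hBar z
        + ∑ i, spaceDeriv i f z * Y.huBar z i))) := by
    refine tendsto_integral_of_dominated_convergence
      (fun z => K * |Y.hBar z| + ∑ i, K * |Y.huBar z i|) ?_ ?_ ?_ ?_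
    · intro k
      have hk := (hlip k).lipschitzOnWith (s := slab n T)
      refine ((aestronglyMeasurable_timeDeriv hk).mono_measure hle |>.mul
        hh.aestronglyMeasurable).add ?_
      refine Finset.aestronglyMeasurable_fun_sum _ fun i _ => ?_
      exact ((aestronglyMeasurable_spaceDeriv hk i).mono_measure hle).mul
        (integrable_apply hhu i).aestronglyMeasurable
    · refine (hh.abs.const_mul _).add (integrable_finsetSum _ fun i _ => ?_)
      exact (integrable_apply hhu i).abs.const_mul _
    · intro k
      have hk := (hlip k).lipschitzOnWith (s := slab n T)
      filter_upwards [ae_mono hle (ae_abs_timeDeriv_le hk),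
        ae_restrict_mem (measurableSet_slab τ)] with z hz hzm
      refine (norm_add_le _ _).trans (add_le_add ?_ ((norm_sum_le _ _).trans
        (Finset.sum_le_sum fun i _ => ?_)))
      · rw [Real.norm_eq_abs, abs_mul]
        gcongr
      · rw [Real.norm_eq_abs, abs_mul]
        gcongr
        exact abs_spaceDeriv_le hk i (hsub hzm)
    · filter_upwards [ae_mono hle htime, ae_mono hle (ae_all_iff.2 hspace)] with z hz hz2
      exact (hz.mul_const _).add (tendsto_finsetSum _ fun i _ => (hz2 i).mul_const _)
  have hψc : ∀ k, Continuous (ψ k) := fun k => (hlip k).continuous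
  have L2 : Tendsto (fun k => ∫ x : Torus n, (ψ k (0, x) * h₀ x - ψ k (τ, x) * Y.hBar (τ, x)))
      atTop (𝓝 (∫ x : Torus n, (f (0, x) * h₀ x - f (τ, x) * Y.hBar (τ, x)))) := by
    refine tendsto_integral_of_dominated_convergence
      (fun x => (2 * K + M) * |h₀ x| + (2 * K + M) * |Y.hBar (τ, x)|) ?_ ?_ ?_ ?_
    · intro k
      have hs : ∀ t : ℝ, AEStronglyMeasurable (fun x : Torus n => ψ k (t, x)) volume := fun t =>
        ((hψc k).comp (by fun_prop)).aestronglyMeasurable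
      exact ((hs 0).mul hY.integrable_h₀.aestronglyMeasurable).sub
        ((hs τ).mul hslice.aestronglyMeasurable)
    · exact (hY.integrable_h₀.abs.const_mul _).add (hslice.abs.const_mul _)
    · intro k
      refine Eventually.of_forall fun x => ?_
      refine (norm_sub_le _ _).trans (add_le_add ?_ ?_)
      · rw [Real.norm_eq_abs, abs_mul]
        gcongr
        exact hbd' k _ ⟨hT0, mem_univ _⟩
      · rw [Real.norm_eq_abs, abs_mul]
        gcongr
        exact hbd' k _ ⟨hτm, mem_univ _⟩
    · refine Eventually.of_forall fun x => ?_
      exact ((hlim _ ⟨hT0, mem_univ _⟩).mul_const _).sub ((hlim _ ⟨hτm, mem_univ _⟩).mul_const _)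
  refine tendsto_nhds_unique (L1.add L2) ?_
  simp only [hτ]
  exact tendsto_const_nhds

end GenYoungMeasure

end MassEquation

/-! ### The relative energy density -/

/-- The relative pressure potential `s ^ γ - h ^ γ - γ h ^ (γ - 1) (s - h)`. -/
def relPressure (γ h s : ℝ) : ℝ := s ^ γ - h ^ γ - γ * h ^ (γ - 1) * (s - h)

/-- Strict Bernoulli inequality `1 + γ x < (1 + x) ^ γ` at `x = s / h - 1`, multiplied by `h ^ γ`.
-/
theorem relPressure_pos {γ h s : ℝ} (hγ : 1 < γ) (hh : 0 < h) (hs : 0 ≤ s) (hne : s ≠ h) :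
    0 < relPressure γ h s := by
  have h1 : -1 ≤ s / h - 1 := by
    have : 0 ≤ s / h := by positivity
    linarith
  have h2 : s / h - 1 ≠ 0 := by
    intro h0
    exact hne ((div_eq_one_iff_eq hh.ne').1 (by linarith))
  have h3 := one_add_mul_self_lt_rpow_one_add h1 h2 hγ
  rw [add_sub_cancel, Real.div_rpow hs hh.le, lt_div_iff₀ (by positivity)] at h3
  have h4 : h ^ γ = h ^ (γ - 1) * h := by
    rw [Real.rpow_sub_one hh.ne', div_mul_cancel₀ _ hh.ne']
  have h5 : (1 + γ * (s / h - 1)) * h ^ γ = h ^ γ + γ * h ^ (γ - 1) * (s - h) := by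
    rw [h4]; field_simp
  rw [relPressure]
  linarith

theorem relPressure_nonneg {γ h s : ℝ} (hγ : 1 < γ) (hh : 0 ≤ h) (hs : 0 ≤ s) :
    0 ≤ relPressure γ h s := by
  -- The case `h = 0` leaves `s ^ γ`, since `0 ^ γ = 0 ^ (γ - 1) = 0` for `γ > 1`. It is kept
  -- because the zero reference state describes the concentrations.
  rcases hh.eq_or_lt with rfl | hh
  · rw [relPressure, Real.zero_rpow (by linarith), Real.zero_rpow (by linarith)]
    have := Real.rpow_nonneg hs γ
    linarith
  · rcases eq_or_ne s h with rfl | hne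
    · simp [relPressure]
    · exact (relPressure_pos hγ hh hs hne).le

/-- The energy of a state `l` relative to the state of height `h` and velocity `u`. -/
def relEnergy (κ γ h : ℝ) (u : Vec n) (l : State n) : ℝ :=
  1 / 2 * ‖l.2 - √(l.1 : ℝ) • u‖ ^ 2 + κ / (γ - 1) * relPressure γ h l.1

/-- The density of production of relative energy at velocity gradient `A`. -/
def relFlux (κ γ h : ℝ) (u : Vec n) (A : Fin n → Fin n → ℝ) (l : State n) : ℝ :=
  -(∑ i, ∑ j, A i j * ((l.2 i - √(l.1 : ℝ) * u i) * (l.2 j - √(l.1 : ℝ) * u j)))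
    - κ * (∑ i, A i i) * relPressure γ h l.1

section Pointwise

variable {κ γ h : ℝ} {u : Vec n} {A : Fin n → Fin n → ℝ}

theorem relEnergy_nonneg (hκ : 0 < κ) (hγ : 1 < γ) (hh : 0 ≤ h) (l : State n) :
    0 ≤ relEnergy κ γ h u l := by
  have h1 := relPressure_nonneg hγ hh l.1.coe_nonneg
  have h2 : 0 < γ - 1 := by linarith
  rw [relEnergy]
  positivity

/-- Both summands are nonnegative, so both vanish: the pressure part fixes the height, and then the
kinetic part fixes `l'`. -/
theorem eq_of_relEnergy_eq_zero (hκ : 0 < κ) (hγ : 1 < γ) (hh : 0 < h) {l : State n}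
    (h0 : relEnergy κ γ h u l = 0) : l = (h.toNNReal, √h • u) := by
  have h1 := relPressure_nonneg hγ hh.le l.1.coe_nonneg
  have h2 : 0 < γ - 1 := by linarith
  have h3 : 0 < κ / (γ - 1) := by positivity
  have hsq : (0 : ℝ) ≤ 1 / 2 * ‖l.2 - √(l.1 : ℝ) • u‖ ^ 2 := by positivity
  have hpr : 0 ≤ κ / (γ - 1) * relPressure γ h l.1 := by positivity
  rw [relEnergy] at h0
  have h4 : relPressure γ h l.1 = 0 := by
    rcases mul_eq_zero.1 (le_antisymm (by linarith) hpr) with h | h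
    · exact absurd h h3.ne'
    · exact h
  have h5 : (l.1 : ℝ) = h := by
    by_contra hne
    exact (relPressure_pos hγ hh l.1.coe_nonneg hne).ne' h4
  have h6 : ‖l.2 - √(l.1 : ℝ) • u‖ ^ 2 = 0 := by linarith
  rw [sq_eq_zero_iff, norm_eq_zero, sub_eq_zero, h5] at h6
  refine Prod.ext ?_ h6
  rw [← h5]
  exact (Real.toNNReal_coe).symm

/-- With `w = l' - √l₁ u`, the quadratic form is at most `n² L |w|²`, which is `2 n² L` times the
kinetic part. The trace is at most `n L`, and `κ` times the relative pressure is `γ - 1` times the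
potential part. Adding the two constants costs only nonnegative cross terms. -/
theorem relFlux_le (hκ : 0 < κ) (hγ : 1 < γ) (hh : 0 ≤ h) {L : ℝ} (hA : ∀ i j, |A i j| ≤ L)
    (hL : 0 ≤ L) (l : State n) :
    relFlux κ γ h u A l ≤ (2 * n ^ 2 * L + n * L * (γ - 1)) * relEnergy κ γ h u l := by
  have h1 := relPressure_nonneg hγ hh l.1.coe_nonneg
  have h2 : 0 < γ - 1 := by linarith
  set w : Vec n := l.2 - √(l.1 : ℝ) • u with hw
  have hwi : ∀ i, l.2 i - √(l.1 : ℝ) * u i = w i := fun i => by simp [hw]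
  have hwn : ∀ i, |w i| ≤ ‖w‖ := fun i => PiLp.norm_apply_le w i
  have hq : -(∑ i, ∑ j, A i j * (w i * w j)) ≤ n ^ 2 * L * ‖w‖ ^ 2 := by
    refine (neg_le_abs _).trans ((Finset.abs_sum_le_sum_abs _ _).trans ?_)
    have : ∀ i ∈ Finset.univ, |∑ j, A i j * (w i * w j)| ≤ n * (L * ‖w‖ ^ 2) := by
      intro i _
      refine (Finset.abs_sum_le_sum_abs _ _).trans ?_
      refine (Finset.sum_le_card_nsmul _ _ (L * ‖w‖ ^ 2) fun j _ => ?_).trans_eq (by simp)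
      rw [abs_mul, abs_mul, sq]
      gcongr
      · exact hA i j
      · exact hwn i
      · exact hwn j
    refine (Finset.sum_le_card_nsmul _ _ _ this).trans_eq ?_
    simp
    ring
  have ht : -(∑ i, A i i) ≤ n * L := by
    refine (neg_le_abs _).trans ((Finset.abs_sum_le_sum_abs _ _).trans ?_)
    exact (Finset.sum_le_card_nsmul _ _ _ fun i _ => hA i i).trans_eq (by simp)
  have ht2 : -(∑ i, A i i) * (κ * relPressure γ h l.1) ≤ n * L * (κ * relPressure γ h l.1) :=
    mul_le_mul_of_nonneg_right ht (by positivity)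
  have h3 : (γ - 1) * (κ / (γ - 1) * relPressure γ h l.1) = κ * relPressure γ h l.1 := by
    field_simp
  have h4 : 0 ≤ κ / (γ - 1) * relPressure γ h l.1 := by positivity
  rw [relFlux, relEnergy, ← hw]
  simp only [hwi]
  have h5 : 0 ≤ 2 * n ^ 2 * L * (κ / (γ - 1) * relPressure γ h l.1) := by positivity
  have h6 : 0 ≤ n * L * (γ - 1) * (1 / 2 * ‖w‖ ^ 2) := by positivity
  have h7 : n * L * (γ - 1) * (κ / (γ - 1) * relPressure γ h l.1)
      = n * L * (κ * relPressure γ h l.1) := by rw [← h3]; ring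
  nlinarith [hq, ht2, h5, h6, h7]

/-- The zero reference state turns the relative energy into its recession function, so `relFlux_le`
also covers concentrations. -/
theorem relEnergy_zero (hγ : 1 < γ) : relEnergy κ γ 0 (0 : Vec n) = energyDensity κ γ := by
  funext l
  simp [relEnergy, energyDensity, relPressure, Real.zero_rpow (show γ ≠ 0 by linarith),
    Real.zero_rpow (show γ - 1 ≠ 0 by linarith)]

theorem relFlux_zero (hγ : 1 < γ) (l : State n) : relFlux κ γ 0 (0 : Vec n) A l =
    -(∑ i, ∑ j, A i j * (l.2 i * l.2 j)) - κ * (∑ i, A i i) * (l.1 : ℝ) ^ γ := by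
  simp [relFlux, relPressure, Real.zero_rpow (show γ ≠ 0 by linarith),
    Real.zero_rpow (show γ - 1 ≠ 0 by linarith)]

end Pointwise

/-! ### Moments -/

/-- `f` is integrable with integral `v`. -/
def HasInt {α : Type*} [MeasurableSpace α] (μ : Measure α) (f : α → ℝ) (v : ℝ) : Prop :=
  Integrable f μ ∧ ∫ x, f x ∂μ = v

namespace HasInt

variable {α : Type*} [MeasurableSpace α] {μ : Measure α} {f g : α → ℝ} {v w : ℝ}

theorem add (hf : HasInt μ f v) (hg : HasInt μ g w) : HasInt μ (fun x => f x + g x) (v + w) :=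
  ⟨hf.1.add hg.1, by rw [integral_add hf.1 hg.1, hf.2, hg.2]⟩

theorem sub (hf : HasInt μ f v) (hg : HasInt μ g w) : HasInt μ (fun x => f x - g x) (v - w) :=
  ⟨hf.1.sub hg.1, by rw [integral_sub hf.1 hg.1, hf.2, hg.2]⟩

theorem neg (hf : HasInt μ f v) : HasInt μ (fun x => -f x) (-v) :=
  ⟨hf.1.neg, by rw [integral_neg, hf.2]⟩

theorem const_mul (c : ℝ) (hf : HasInt μ f v) : HasInt μ (fun x => c * f x) (c * v) :=
  ⟨hf.1.const_mul c, by rw [integral_const_mul, hf.2]⟩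

theorem const [IsProbabilityMeasure μ] (c : ℝ) : HasInt μ (fun _ => c) c :=
  ⟨integrable_const c, by simp⟩

theorem sum {ι : Type*} [Fintype ι] {f : ι → α → ℝ} {v : ι → ℝ} (h : ∀ i, HasInt μ (f i) (v i)) :
    HasInt μ (fun x => ∑ i, f i x) (∑ i, v i) :=
  ⟨integrable_finsetSum _ fun i _ => (h i).1, by
    rw [integral_finsetSum _ fun i _ => (h i).1]
    exact Finset.sum_congr rfl fun i _ => (h i).2⟩

theorem congr_fun (hf : HasInt μ f v) (h : ∀ x, g x = f x) : HasInt μ g v := by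
  rwa [funext h]

end HasInt

section Moments

variable {μ : Measure (State n)} {κ γ : ℝ} {a p : ℝ} {b : Fin n → ℝ}
  {M : Fin n → Fin n → ℝ}

theorem hasInt_energyDensity (hM : ∀ i j, HasInt μ (fun l => l.2 i * l.2 j) (M i j))
    (hp : HasInt μ (fun l => (l.1 : ℝ) ^ γ) p) :
    HasInt μ (energyDensity κ γ) (1 / 2 * ∑ i, M i i + κ / (γ - 1) * p) := by
  refine (((HasInt.sum fun i => hM i i).const_mul (1 / 2)).add
    (hp.const_mul (κ / (γ - 1)))).congr_fun fun l => ?_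
  rw [energyDensity, EuclideanSpace.real_norm_sq_eq]
  simp only [sq]

variable [IsProbabilityMeasure μ]

theorem hasInt_relPressure (ha : HasInt μ (fun l => (l.1 : ℝ)) a)
    (hp : HasInt μ (fun l => (l.1 : ℝ) ^ γ) p) (h : ℝ) :
    HasInt μ (fun l => relPressure γ h l.1) (p - h ^ γ - γ * h ^ (γ - 1) * (a - h)) :=
  (hp.sub (HasInt.const _)).sub ((ha.sub (HasInt.const _)).const_mul _)

/-- With the reference state frozen, expanding the square uses `(√l₁)² = l₁` and leaves only moments
whose existence is part of the notion of solution. -/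
theorem hasInt_relEnergy (ha : HasInt μ (fun l => (l.1 : ℝ)) a)
    (hb : ∀ i, HasInt μ (fun l => √(l.1 : ℝ) * l.2 i) (b i))
    (hM : ∀ i j, HasInt μ (fun l => l.2 i * l.2 j) (M i j))
    (hp : HasInt μ (fun l => (l.1 : ℝ) ^ γ) p) (h : ℝ) (u : Vec n) :
    HasInt μ (relEnergy κ γ h u)
      (1 / 2 * (∑ i, (M i i - 2 * u i * b i + u i * u i * a))
        + κ / (γ - 1) * (p - h ^ γ - γ * h ^ (γ - 1) * (a - h))) := by
  refine (((HasInt.sum fun i => ((hM i i).sub ((hb i).const_mul (2 * u i))).add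
    (ha.const_mul (u i * u i))).const_mul (1 / 2)).add
    ((hasInt_relPressure ha hp h).const_mul (κ / (γ - 1)))).congr_fun fun l => ?_
  rw [relEnergy, EuclideanSpace.real_norm_sq_eq]
  congr 2
  refine Finset.sum_congr rfl fun i _ => ?_
  have := Real.mul_self_sqrt l.1.coe_nonneg
  simp only [PiLp.sub_apply, PiLp.smul_apply, smul_eq_mul]
  linear_combination (u i * u i) * this

theorem hasInt_relFlux (ha : HasInt μ (fun l => (l.1 : ℝ)) a)
    (hb : ∀ i, HasInt μ (fun l => √(l.1 : ℝ) * l.2 i) (b i))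
    (hM : ∀ i j, HasInt μ (fun l => l.2 i * l.2 j) (M i j))
    (hp : HasInt μ (fun l => (l.1 : ℝ) ^ γ) p) (h : ℝ) (u : Vec n) (A : Fin n → Fin n → ℝ) :
    HasInt μ (relFlux κ γ h u A)
      (-(∑ i, ∑ j, A i j * (M i j - u j * b i - u i * b j + u i * u j * a))
        - κ * (∑ i, A i i) * (p - h ^ γ - γ * h ^ (γ - 1) * (a - h))) := by
  refine ((HasInt.sum fun i => HasInt.sum fun j => ((((hM i j).sub ((hb i).const_mul (u j))).sub
    ((hb j).const_mul (u i))).add (ha.const_mul (u i * u j))).const_mul (A i j)).neg.sub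
    ((hasInt_relPressure ha hp h).const_mul (κ * ∑ i, A i i))).congr_fun fun l => ?_
  rw [relFlux]
  congr 2
  refine Finset.sum_congr rfl fun i _ => Finset.sum_congr rfl fun j _ => ?_
  have := Real.mul_self_sqrt l.1.coe_nonneg
  linear_combination (A i j * u i * u j) * this

end Moments

/-! ### The concentration part -/

theorem continuous_height_rpow {p : ℝ} (hp : 0 ≤ p) : Continuous fun l : State n => (l.1 : ℝ) ^ p :=
  (NNReal.continuous_coe.comp continuous_fst).rpow_const fun _ => Or.inr hp

theorem continuous_velocity_mul (i j : Fin n) : Continuous fun l : State n => l.2 i * l.2 j := by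
  fun_prop

theorem continuous_energyDensity {κ γ : ℝ} (hγ : 1 < γ) :
    Continuous (energyDensity (n := n) κ γ) := by
  have := continuous_height_rpow (n := n) (p := γ) (by linarith)
  unfold energyDensity
  fun_prop

/-- Both terms of the defining equation are nonnegative, so each is at most `1`. Compactness makes
every continuous function integrable against `ν^∞`. -/
theorem isCompact_SPlus {γ : ℝ} (hγ : 1 < γ) : IsCompact (SPlus n γ) := by
  have hc : IsClosed (SPlus n γ) := by
    have := continuous_height_rpow (n := n) (p := 2 * γ) (by linarith)
    exact isClosed_eq (by fun_prop) continuous_const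
  refine (isCompact_Icc.prod (isCompact_closedBall (0 : Vec n) 1)).of_isClosed_subset
    (s := Icc (0 : ℝ≥0) 1 ×ˢ Metric.closedBall (0 : Vec n) 1) hc fun b hb => ?_
  have hb' : (b.1 : ℝ) ^ (2 * γ) + ‖b.2‖ ^ 4 = 1 := hb
  have h1 : (0 : ℝ) ≤ (b.1 : ℝ) ^ (2 * γ) := Real.rpow_nonneg b.1.coe_nonneg _
  have h2 : 0 ≤ ‖b.2‖ ^ 4 := by positivity
  refine ⟨⟨zero_le, ?_⟩, ?_⟩
  · by_contra hlt
    push Not at hlt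
    have := Real.one_lt_rpow (show (1 : ℝ) < b.1 by exact_mod_cast hlt)
      (show 0 < 2 * γ by linarith)
    linarith
  · rw [mem_closedBall_zero_iff]
    by_contra hlt
    push Not at hlt
    have := one_lt_pow₀ hlt (n := 4) (by norm_num)
    linarith

/-- The energy vanishes only at the origin, which is not on the sphere. This is what finally forces
`m = 0`. -/
theorem energyDensity_pos_of_mem_SPlus {κ γ : ℝ} (hκ : 0 < κ) (hγ : 1 < γ) {l : State n}
    (hl : l ∈ SPlus n γ) : 0 < energyDensity κ γ l := by
  have h2 : 0 < γ - 1 := by linarith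
  have h0 : 0 ≤ (l.1 : ℝ) ^ γ := Real.rpow_nonneg l.1.coe_nonneg _
  rcases eq_or_lt_of_le l.1.coe_nonneg with h | h
  · have hl' : (l.1 : ℝ) ^ (2 * γ) + ‖l.2‖ ^ 4 = 1 := hl
    rw [← h, Real.zero_rpow (by linarith), zero_add] at hl'
    have : 0 < ‖l.2‖ := by
      rcases (norm_nonneg l.2).eq_or_lt with h' | h'
      · rw [← h'] at hl'; norm_num at hl'
      · exact h'
    rw [energyDensity]
    positivity
  · rw [energyDensity]
    positivity

namespace GenYoungMeasure

variable {γ T : ℝ} {Y : GenYoungMeasure n γ T}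

instance (Y : GenYoungMeasure n γ T) : IsFiniteMeasure Y.m := Y.isFiniteMeasure

theorem aestronglyMeasurable_conc (Y : GenYoungMeasure n γ T) (hγ : 1 < γ) {f : State n → ℝ}
    (hf : Continuous f) :
    AEStronglyMeasurable (Y.conc f) Y.m := by
  have : CompactSpace (SPlus n γ) := isCompact_iff_compactSpace.1 (isCompact_SPlus hγ)
  exact Y.measurable_νInf _ (hf.comp continuous_subtype_val)
    (HasCompactSupport.of_compactSpace _)

theorem exists_conc_bound (Y : GenYoungMeasure n γ T) (hγ : 1 < γ) {f : State n → ℝ}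
    (hf : Continuous f) : ∃ C, ∀ z, |Y.conc f z| ≤ C := by
  obtain ⟨C, hC⟩ := (isCompact_SPlus (n := n) hγ).exists_bound_of_continuousOn hf.continuousOn
  refine ⟨C, fun z => ?_⟩
  have := norm_integral_le_of_norm_le_const (μ := (Y.νInf z : Measure (SPlus n γ)))
    (f := fun b => f b) (C := C) (Eventually.of_forall fun b => hC b b.2)
  simp only [probReal_univ, mul_one] at this
  exact this

theorem hasInt_conc (Y : GenYoungMeasure n γ T) (hγ : 1 < γ) {f : State n → ℝ}
    (hf : Continuous f) (z : ℝ × Torus n) :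
    HasInt (Y.νInf z : Measure (SPlus n γ)) (fun b => f b) (Y.conc f z) := by
  have : CompactSpace (SPlus n γ) := isCompact_iff_compactSpace.1 (isCompact_SPlus hγ)
  exact ⟨(hf.comp continuous_subtype_val).integrable_of_hasCompactSupport
    (HasCompactSupport.of_compactSpace _), rfl⟩

theorem integrableOn_mul_conc (Y : GenYoungMeasure n γ T) (hγ : 1 < γ) {f : State n → ℝ}
    (hf : Continuous f) {g : ℝ × Torus n → ℝ} {A : Set (ℝ × Torus n)} (hA : A ⊆ slab n T)
    (hAm : MeasurableSet A)
    (hg : ContinuousOn g (slab n T)) : IntegrableOn (fun z => g z * Y.conc f z) A Y.m := by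
  obtain ⟨C, hC⟩ := Y.exists_conc_bound hγ hf
  obtain ⟨D, hD⟩ := (isCompact_slab T).exists_bound_of_continuousOn hg
  have hD' : ∀ᵐ z ∂(Y.m.restrict A), ‖g z‖ ≤ D := by
    filter_upwards [ae_restrict_mem hAm] with z hz using hD z (hA hz)
  refine Integrable.bdd_mul (c := D) ?_ ((hg.mono hA).aestronglyMeasurable hAm) hD'
  exact Integrable.of_bound (Y.aestronglyMeasurable_conc hγ hf).restrict C
    (Eventually.of_forall fun z => hC z)

theorem integrable_conc (Y : GenYoungMeasure n γ T) (hγ : 1 < γ) {f : State n → ℝ}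
    (hf : Continuous f) : Integrable (Y.conc f) Y.m := by
  obtain ⟨C, hC⟩ := Y.exists_conc_bound hγ hf
  exact Integrable.of_bound (Y.aestronglyMeasurable_conc hγ hf) C
    (Eventually.of_forall fun z => hC z)

theorem conc_energyDensity_pos (Y : GenYoungMeasure n γ T) {κ : ℝ} (hκ : 0 < κ) (hγ : 1 < γ)
    (z : ℝ × Torus n) : 0 < Y.conc (energyDensity κ γ) z := by
  have hpos : ∀ b : SPlus n γ, 0 < energyDensity κ γ (b : State n) := fun b =>
    energyDensity_pos_of_mem_SPlus hκ hγ b.2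
  refine (integral_pos_iff_support_of_nonneg (fun b => (hpos b).le)
    (Y.hasInt_conc hγ (continuous_energyDensity hγ) z).1).2 ?_
  rw [Function.support_eq_univ fun b => (hpos b).ne']
  simp

/-- The concentration part of the production of relative energy is controlled by that of
the energy. -/
theorem conc_flux_le (Y : GenYoungMeasure n γ T) {κ : ℝ} (hκ : 0 < κ) (hγ : 1 < γ)
    {A : Fin n → Fin n → ℝ} {L : ℝ} (hA : ∀ i j, |A i j| ≤ L) (hL : 0 ≤ L) (z : ℝ × Torus n) :
    -(∑ i, ∑ j, A i j * Y.conc (fun l => l.2 i * l.2 j) z)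
      - κ * ((∑ i, A i i) * Y.conc (fun l => (l.1 : ℝ) ^ γ) z)
      ≤ (2 * n ^ 2 * L + n * L * (γ - 1)) * Y.conc (energyDensity κ γ) z := by
  have h1 := ((HasInt.sum fun i => HasInt.sum fun j =>
    (Y.hasInt_conc hγ (continuous_velocity_mul i j) z).const_mul (A i j)).neg).sub
      (((Y.hasInt_conc hγ (continuous_height_rpow (n := n) (p := γ) (by linarith)) z).const_mul
        (∑ i, A i i)).const_mul κ)
  have h2 := (Y.hasInt_conc hγ (continuous_energyDensity (κ := κ) hγ) z).const_mul
    (2 * n ^ 2 * L + n * L * (γ - 1))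
  rw [← h1.2, ← h2.2]
  refine integral_mono h1.1 h2.1 fun b => ?_
  -- The pointwise bound at the reference state `(0, 0)`, where flux and energy are their own
  -- recession functions.
  have := relFlux_le (u := (0 : Vec n)) hκ hγ le_rfl hA hL (b : State n)
  rw [relFlux_zero hγ, relEnergy_zero hγ, mul_assoc] at this
  exact this

/-! ### The oscillation part -/

section Osc

variable {κ : ℝ} {G : ℝ × Torus n → Vec n} {h₀ : Torus n → ℝ} {u₀ : Torus n → Vec n}

/-- The second moments `⟨l'ᵢ l'ⱼ, ν⟩`. -/
def huuBar (Y : GenYoungMeasure n γ T) (i j : Fin n) : ℝ × Torus n → ℝ :=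
  Y.osc fun l => l.2 i * l.2 j

/-- The moment `⟨l₁ ^ γ, ν⟩`. -/
def hpBar (Y : GenYoungMeasure n γ T) : ℝ × Torus n → ℝ :=
  Y.osc fun l => (l.1 : ℝ) ^ γ

theorem IsSolution.integrableOn_huuBar (hY : Y.IsSolution κ G h₀ u₀) (i j : Fin n) :
    IntegrableOn (Y.huuBar i j) (slab n T) := (hY.integrable_huu i j).2

theorem IsSolution.integrableOn_hpBar (hY : Y.IsSolution κ G h₀ u₀) :
    IntegrableOn Y.hpBar (slab n T) := hY.integrable_pressure.2

/-- All moments exist at the point `z`. -/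
structure HasMoments (Y : GenYoungMeasure n γ T) (z : ℝ × Torus n) : Prop where
  h : HasInt (Y.ν z : Measure (State n)) (fun l => (l.1 : ℝ)) (Y.hBar z)
  hu : ∀ i, HasInt (Y.ν z : Measure (State n)) (fun l => √(l.1 : ℝ) * l.2 i) (Y.huBar z i)
  huu : ∀ i j, HasInt (Y.ν z : Measure (State n)) (fun l => l.2 i * l.2 j) (Y.huuBar i j z)
  pressure : HasInt (Y.ν z : Measure (State n)) (fun l => (l.1 : ℝ) ^ γ) (Y.hpBar z)
  hG : ∀ G : ℝ × Torus n → Vec n, Y.hGBar G z = Y.hBar z • G z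
  power : ∀ G : ℝ × Torus n → Vec n, Y.hGuBar G z = inner ℝ (G z) (Y.huBar z)

/-- For fixed `z` the force `G z` is a constant vector under `ν_z`, so the two force moments reduce
to the mean height and mean momentum. -/
theorem IsSolution.ae_hasMoments (hY : Y.IsSolution κ G h₀ u₀) :
    ∀ᵐ z ∂(volume.restrict (slab n T)), Y.HasMoments z := by
  filter_upwards [hY.integrable_h.1, hY.integrable_hu.1,
    ae_all_iff.2 fun i => ae_all_iff.2 fun j => (hY.integrable_huu i j).1,
    hY.integrable_pressure.1] with z h1 h2 h3 h4
  refine ⟨⟨h1, rfl⟩, fun i => ⟨?_, ?_⟩, fun i j => ⟨h3 i j, rfl⟩, ⟨h4, rfl⟩, fun G => ?_, fun G => ?_⟩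
  · exact integrable_apply h2 i
  · exact (EuclideanSpace.proj (𝕜 := ℝ) i).integral_comp_comm h2
  · exact integral_smul_const _ _
  · exact integral_inner h2 (G z)

theorem IsSolution.ae_osc_energyDensity (hY : Y.IsSolution κ G h₀ u₀) :
    ∀ᵐ z ∂(volume.restrict (slab n T)), Y.osc (energyDensity κ γ) z =
      1 / 2 * ∑ i, Y.huuBar i i z + κ / (γ - 1) * Y.hpBar z := by
  filter_upwards [hY.ae_hasMoments] with z hz
  exact (hasInt_energyDensity hz.huu hz.pressure).2

theorem IsSolution.integrableOn_osc_energyDensity (hY : Y.IsSolution κ G h₀ u₀) :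
    IntegrableOn (Y.osc (energyDensity κ γ)) (slab n T) := by
  refine Integrable.congr ?_ (hY.ae_osc_energyDensity.mono fun z hz => hz.symm)
  exact ((integrable_finsetSum _ fun i _ => hY.integrableOn_huuBar i i).const_mul _).add
    (hY.integrableOn_hpBar.const_mul _)

end Osc

end GenYoungMeasure

/-! ### The integrated energy inequality -/

/-- Smooth cut-offs converging to the indicator of `[0, τ]` on `[0, ∞)`. -/
theorem exists_smooth_cutoff {τ : ℝ} (hτ : 0 ≤ τ) :
    ∃ χ : ℕ → ℝ → ℝ, (∀ k, ContDiff ℝ ∞ (χ k)) ∧ (∀ k, HasCompactSupport (χ k)) ∧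
      (∀ k t, 0 ≤ χ k t) ∧ (∀ k t, χ k t ≤ 1) ∧ (∀ k, ∀ t ∈ Icc 0 τ, χ k t = 1) ∧
      (∀ t, τ < t → ∀ᶠ k in atTop, χ k t = 0) := by
  have hpos : ∀ k : ℕ, 0 < 1 / ((k : ℝ) + 1) := fun k => by positivity
  -- Centred at `τ / 2`: the inner ball contains `[0, τ]`, and the outer ball shrinks to it. The
  -- extra `1 / (k + 1)` keeps the radii positive when `τ = 0`.
  let χ : ∀ _ : ℕ, ContDiffBump (τ / 2) := fun k =>
    ⟨τ / 2 + 1 / ((k : ℝ) + 1), τ / 2 + 2 * (1 / ((k : ℝ) + 1)), by have := hpos k; linarith,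
      by have := hpos k; linarith⟩
  refine ⟨fun k => χ k, fun k => (χ k).contDiff, fun k => (χ k).hasCompactSupport,
    fun k t => (χ k).nonneg, fun k t => (χ k).le_one, fun k t ht => ?_, fun t ht => ?_⟩
  · refine (χ k).one_of_mem_closedBall ?_
    rw [Metric.mem_closedBall, Real.dist_eq, abs_le]
    have := hpos k
    show -(τ / 2 + 1 / ((k : ℝ) + 1)) ≤ t - τ / 2 ∧ t - τ / 2 ≤ τ / 2 + 1 / ((k : ℝ) + 1)
    constructor <;> linarith [ht.1, ht.2]
  · have hlim := (tendsto_one_div_add_atTop_nhds_zero_nat (𝕜 := ℝ)).const_mul 2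
    rw [mul_zero] at hlim
    filter_upwards [hlim.eventually (gt_mem_nhds (sub_pos.2 ht))] with k hk
    refine (χ k).zero_of_le_dist ?_
    rw [Real.dist_eq, le_abs]
    left
    show τ / 2 + 2 * (1 / ((k : ℝ) + 1)) ≤ t - τ / 2
    linarith

/-- The time function `a` and the measure are left general, to serve space-time with Lebesgue
measure, space-time with `m`, and the time interval. The limit set is closed at `τ`, so mass that
`m` may carry at time `τ` is counted. -/
theorem tendsto_integral_cutoff {α : Type*} [MeasurableSpace α] {μ : Measure α} {a : α → ℝ}
    (ha : Measurable a) (ha0 : ∀ᵐ z ∂μ, 0 ≤ a z) {u : α → ℝ} (hu : Integrable u μ) {τ : ℝ}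
    {χ : ℕ → ℝ → ℝ} (hc : ∀ k, Continuous (χ k)) (h0 : ∀ k t, 0 ≤ χ k t)
    (h1 : ∀ k t, χ k t ≤ 1) (hin : ∀ k, ∀ t ∈ Icc 0 τ, χ k t = 1)
    (hout : ∀ t, τ < t → ∀ᶠ k in atTop, χ k t = 0) :
    Tendsto (fun k => ∫ z, χ k (a z) * u z ∂μ) atTop (𝓝 (∫ z in a ⁻¹' Iic τ, u z ∂μ)) := by
  rw [← integral_indicator (ha measurableSet_Iic)]
  refine tendsto_integral_of_dominated_convergence (fun z => |u z|) (fun k => ?_) hu.abs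
    (fun k => Eventually.of_forall fun z => ?_) ?_
  · exact (((hc k).measurable.comp ha).aestronglyMeasurable).mul hu.aestronglyMeasurable
  · rw [Real.norm_eq_abs, abs_mul, abs_of_nonneg (h0 _ _)]
    exact mul_le_of_le_one_left (abs_nonneg _) (h1 _ _)
  · filter_upwards [ha0] with z hz
    rcases le_or_gt (a z) τ with h | h
    · rw [indicator_of_mem (show z ∈ a ⁻¹' Iic τ from h)]
      simp only [hin _ _ ⟨hz, h⟩, one_mul]
      exact tendsto_const_nhds
    · rw [indicator_of_notMem (show z ∉ a ⁻¹' Iic τ from not_le.2 h)]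
      refine tendsto_const_nhds.congr' ?_
      filter_upwards [hout _ h] with k hk
      rw [hk, zero_mul]

theorem slab_inter {τ T : ℝ} (h : τ ≤ T) :
    Prod.fst ⁻¹' Iic τ ∩ slab n T = slab n τ := by
  ext z
  simp only [slab, mem_inter_iff, mem_preimage, mem_Iic, mem_prod, mem_Icc, mem_univ, and_true]
  constructor
  · rintro ⟨h1, h2, h3⟩; exact ⟨h2, h1⟩
  · rintro ⟨h1, h2⟩; exact ⟨h2, h1, h2.trans h⟩

theorem tendsto_setIntegral_slab_cutoff {T τ : ℝ} (hτ : τ ≤ T) {μ : Measure (ℝ × Torus n)}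
    {u : ℝ × Torus n → ℝ} (hu : IntegrableOn u (slab n T) μ)
    {χ : ℕ → ℝ → ℝ} (hc : ∀ k, Continuous (χ k)) (h0 : ∀ k t, 0 ≤ χ k t)
    (h1 : ∀ k t, χ k t ≤ 1) (hin : ∀ k, ∀ t ∈ Icc 0 τ, χ k t = 1)
    (hout : ∀ t, τ < t → ∀ᶠ k in atTop, χ k t = 0) :
    Tendsto (fun k => ∫ z in slab n T, χ k z.1 * u z ∂μ) atTop (𝓝 (∫ z in slab n τ, u z ∂μ)) := by
  have ha0 : ∀ᵐ z ∂μ.restrict (slab n T), 0 ≤ z.1 := by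
    filter_upwards [ae_restrict_mem (measurableSet_slab T)] with z hz using hz.1.1
  have := tendsto_integral_cutoff measurable_fst ha0 hu hc h0 h1 hin hout
  rwa [Measure.restrict_restrict (measurable_fst measurableSet_Iic), slab_inter hτ] at this

theorem continuousOn_setIntegral_slab {T : ℝ} {f : ℝ × Torus n → ℝ}
    (hf : IntegrableOn f (slab n T)) :
    ContinuousOn (fun t => ∫ z in slab n t, f z) (Icc 0 T) := by
  have h := intervalIntegral.continuousOn_primitive_Icc (integrableOn_integral_slice hf)
  refine h.congr fun t ht => ?_
  exact setIntegral_slab (hf.mono_set (slab_subset ht.2))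

/-- Admissibility is tested with the cut-offs. Both sides are integrated over `[0, τ]`, since the
energy measure may have a singular part in time. -/
theorem GenYoungMeasure.IsAdmissible.energy_slab_le {γ T κ : ℝ} {Y : GenYoungMeasure n γ T}
    (hγ : 1 < γ) {G : ℝ × Torus n → Vec n} {h₀ : Torus n → ℝ} {u₀ : Torus n → Vec n}
    (hY : Y.IsSolution κ G h₀ u₀) (hadm : Y.IsAdmissible κ G h₀ u₀) {τ : ℝ} (hτ : τ ∈ Icc 0 T) :
    (∫ z in slab n τ, Y.osc (energyDensity κ γ) z)
        + ∫ z in slab n τ, Y.conc (energyDensity κ γ) z ∂Y.m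
      ≤ ∫ t in Icc 0 τ, (initialEnergy κ γ h₀ u₀ + ∫ z in slab n t, Y.hGuBar G z) := by
  obtain ⟨χ, hsm, hcs, h0, h1, hin, hout⟩ := exists_smooth_cutoff hτ.1
  have hc : ∀ k, Continuous (χ k) := fun k => (hsm k).continuous
  have L1 := tendsto_setIntegral_slab_cutoff hτ.2 hY.integrableOn_osc_energyDensity hc h0 h1 hin
    hout
  have L2 := tendsto_setIntegral_slab_cutoff (μ := Y.m) hτ.2
    (Y.integrable_conc hγ (continuous_energyDensity (κ := κ) hγ)).integrableOn hc h0 h1 hin hout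
  have hint : IntegrableOn
      (fun t => initialEnergy κ γ h₀ u₀ + ∫ z in slab n t, Y.hGuBar G z) (Icc 0 T) :=
    (continuousOn_const.add (continuousOn_setIntegral_slab hadm.integrable_power.2)).integrableOn_Icc
  have ha0 : ∀ᵐ t ∂(volume : Measure ℝ).restrict (Icc 0 T), 0 ≤ t := by
    filter_upwards [ae_restrict_mem measurableSet_Icc] with t ht using ht.1
  have L3 := tendsto_integral_cutoff measurable_id ha0 hint hc h0 h1 hin hout
  rw [Measure.restrict_restrict (measurable_id measurableSet_Iic)] at L3
  have hset : id ⁻¹' Iic τ ∩ Icc 0 T = Icc 0 τ := by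
    ext t
    simp only [preimage_id, mem_inter_iff, mem_Iic, mem_Icc]
    exact ⟨fun h => ⟨h.2.1, h.1⟩, fun h => ⟨h.2, h.1, h.2.trans hτ.2⟩⟩
  rw [hset] at L3
  exact le_of_tendsto_of_tendsto' (L1.add L2) L3 fun k => hadm.energy_le (χ k) (hsm k) (hcs k) (h0 k)

/-! ### Calculus of the strong solution -/

/-- On `[c, M]` with `c > 0` the derivative of the power is bounded. The lower bound matters: the
exponent `γ - 1` may be less than `1`. -/
theorem exists_lipschitzOnWith_rpow {α : Type*} [PseudoMetricSpace α] {S : Set α} {f : α → ℝ}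
    {c M : ℝ} (hc : 0 < c) (hf : MapsTo f S (Icc c M)) {K : ℝ≥0} (hl : LipschitzOnWith K f S)
    (q : ℝ) : ∃ K' : ℝ≥0, LipschitzOnWith K' (fun z => f z ^ q) S := by
  have hcont : ContinuousOn (fun x : ℝ => q * x ^ (q - 1)) (Icc c M) :=
    continuousOn_const.mul (continuousOn_id.rpow_const fun x hx => Or.inl (hc.trans_le hx.1).ne')
  obtain ⟨C, hC⟩ := isCompact_Icc.exists_bound_of_continuousOn hcont
  have h1 : LipschitzOnWith C.toNNReal (fun x : ℝ => x ^ q) (Icc c M) := by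
    refine (convex_Icc c M).lipschitzOnWith_of_nnnorm_hasDerivWithin_le
      (f' := fun x => q * x ^ (q - 1)) (fun x hx => ?_) fun x hx => ?_
    · exact (Real.hasDerivAt_rpow_const (Or.inl (hc.trans_le hx.1).ne')).hasDerivWithinAt
    · rw [← NNReal.coe_le_coe, coe_nnnorm]
      exact (hC x hx).trans (Real.le_coe_toNNReal C)
  exact ⟨_, h1.comp hl hf⟩

theorem lipschitzOnWith_const_mul {α : Type*} [PseudoMetricSpace α] {S : Set α} {f : α → ℝ}
    {K : ℝ≥0} (hl : LipschitzOnWith K f S) (a : ℝ) :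
    LipschitzOnWith (‖a‖₊ * K) (fun z => a * f z) S := by
  refine LipschitzOnWith.of_dist_le_mul fun x hx y hy => ?_
  rw [Real.dist_eq, ← mul_sub, abs_mul, NNReal.coe_mul, coe_nnnorm, Real.norm_eq_abs, mul_assoc]
  exact mul_le_mul_of_nonneg_left (hl.dist_le_mul x hx y hy) (abs_nonneg a)

section PointCalculus

/-- The velocity gradient `∂ⱼ Uᵢ`. -/
def velGrad (U : ℝ × Torus n → Vec n) (z : ℝ × Torus n) (i j : Fin n) : ℝ :=
  spaceDeriv j (fun y => U y i) z

variable {T : ℝ} {U : ℝ × Torus n → Vec n}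

theorem IsC1.apply (hU : IsC1 T U) (i : Fin n) : IsC1 T fun y => U y i :=
  (EuclideanSpace.proj (𝕜 := ℝ) i).contDiff.comp_contDiffOn hU

theorem IsC1.timeDeriv_apply (hT : 0 < T) (hU : IsC1 T U) {z : ℝ × Torus n} (hz : z ∈ slab n T)
    (i : Fin n) : timeDeriv T (fun y => U y i) z = timeDeriv T U z i := by
  have := (EuclideanSpace.proj (𝕜 := ℝ) i).hasFDerivAt.comp_hasDerivWithinAt z.1
    (hU.hasDerivWithinAt_time hT hz)
  exact this.derivWithin (uniqueDiffOn_Icc hT _ hz.1)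

theorem IsC1.half_norm_sq (hU : IsC1 T U) : IsC1 T fun y => 1 / 2 * ‖U y‖ ^ 2 :=
  contDiffOn_const.mul (ContDiffOn.norm_sq ℝ hU)

theorem half_norm_sq_eq (v : Vec n) : 1 / 2 * ‖v‖ ^ 2 = 1 / 2 * ∑ i, v i * v i := by
  rw [EuclideanSpace.real_norm_sq_eq]
  simp only [sq]

theorem IsC1.timeDeriv_half_norm_sq (hT : 0 < T) (hU : IsC1 T U) {z : ℝ × Torus n}
    (hz : z ∈ slab n T) :
    timeDeriv T (fun y => 1 / 2 * ‖U y‖ ^ 2) z = ∑ i, U z i * timeDeriv T U z i := by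
  simp only [half_norm_sq_eq]
  refine HasDerivWithinAt.derivWithin ?_ (uniqueDiffOn_Icc hT _ hz.1)
  have h := (HasDerivWithinAt.fun_sum fun i (_ : i ∈ Finset.univ) =>
    ((hU.apply i).hasDerivWithinAt_time hT hz).mul
      ((hU.apply i).hasDerivWithinAt_time hT hz)).const_mul (1 / 2 : ℝ)
  refine h.congr_deriv ?_
  simp only [hU.timeDeriv_apply hT hz]
  rw [Finset.mul_sum]
  exact Finset.sum_congr rfl fun i _ => by ring

theorem IsC1.spaceDeriv_half_norm_sq (hU : IsC1 T U) {z : ℝ × Torus n}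
    (hz : z ∈ slab n T) (j : Fin n) :
    spaceDeriv j (fun y => 1 / 2 * ‖U y‖ ^ 2) z = ∑ i, U z i * velGrad U z i j := by
  simp only [half_norm_sq_eq]
  refine HasDerivAt.deriv ?_
  have h := (HasDerivAt.fun_sum fun i (_ : i ∈ Finset.univ) =>
    ((hU.apply i).hasDerivAt_space hz j).mul
      ((hU.apply i).hasDerivAt_space hz j)).const_mul (1 / 2 : ℝ)
  refine h.congr_deriv ?_
  simp only [AddCircle.coe_zero, Pi.single_zero, add_zero, velGrad]
  rw [Finset.mul_sum]
  exact Finset.sum_congr rfl fun i _ => by ring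

variable {H : ℝ × Torus n → ℝ} {z : ℝ × Torus n}

theorem timeDeriv_const_mul_rpow (hz : z.1 ∈ Ioo 0 T)
    (hH : DifferentiableAt ℝ (fun s => H (s, z.2)) z.1) (hpos : 0 < H z) (a q : ℝ) :
    timeDeriv T (fun y => a * H y ^ q) z = a * (q * H z ^ (q - 1) * timeDeriv T H z) := by
  rw [timeDeriv_eq_deriv _ hz, timeDeriv_eq_deriv _ hz]
  have h := (hH.hasDerivAt.rpow_const (p := q) (Or.inl hpos.ne')).const_mul a
  rw [h.deriv]
  ring

variable {j : Fin n}
  (hH : DifferentiableAt ℝ (fun s : ℝ => H (z.1, z.2 + Pi.single j (s : UnitAddCircle))) 0)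

include hH in
theorem hasDerivAt_space_of_differentiableAt :
    HasDerivAt (fun s : ℝ => H (z.1, z.2 + Pi.single j (s : UnitAddCircle))) (spaceDeriv j H z) 0 :=
  hH.hasDerivAt

include hH in
theorem hasDerivAt_space_const_mul_rpow (hpos : 0 < H z) (a q : ℝ) :
    HasDerivAt (fun s : ℝ => a * H (z.1, z.2 + Pi.single j (s : UnitAddCircle)) ^ q)
      (a * (q * H z ^ (q - 1) * spaceDeriv j H z)) 0 := by
  have h := ((hasDerivAt_space_of_differentiableAt hH).rpow_const (p := q) (by
    left; simpa using hpos.ne')).const_mul a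
  refine h.congr_deriv ?_
  simp only [AddCircle.coe_zero, Pi.single_zero, add_zero]
  ring

end PointCalculus

/-- At `z` the height is differentiable in the coordinate directions, and the Euler equations
hold in expanded form. -/
structure IsRegularPoint (T κ γ : ℝ) (G : ℝ × Torus n → Vec n) (H : ℝ × Torus n → ℝ)
    (U : ℝ × Torus n → Vec n) (z : ℝ × Torus n) : Prop where
  mem : z.1 ∈ Ioo 0 T
  time : DifferentiableAt ℝ (fun s => H (s, z.2)) z.1
  space : ∀ j, DifferentiableAt ℝ
    (fun s : ℝ => H (z.1, z.2 + Pi.single j (s : UnitAddCircle))) 0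
  mass : timeDeriv T H z + ∑ j, (spaceDeriv j H z * U z j + H z * velGrad U z j j) = 0
  momentum : ∀ i, timeDeriv T H z * U z i + H z * timeDeriv T U z i
    + ∑ j, (spaceDeriv j H z * U z i * U z j + H z * velGrad U z i j * U z j
        + H z * U z i * velGrad U z j j)
    + κ * (γ * H z ^ (γ - 1) * spaceDeriv i H z) = H z * G z i

section

variable {T κ γ c : ℝ} {G : ℝ × Torus n → Vec n} {h₀ : Torus n → ℝ} {u₀ : Torus n → Vec n}
  {H : ℝ × Torus n → ℝ} {U : ℝ × Torus n → Vec n}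

theorem IsRegularPoint.mem_slab {z : ℝ × Torus n} (hz : IsRegularPoint T κ γ G H U z) :
    z ∈ slab n T := ⟨Ioo_subset_Icc_self hz.mem, mem_univ _⟩

/-- The product and chain rules expand the conservative form wherever the Lipschitz height has
coordinate derivatives, which is almost everywhere. -/
theorem IsStrongSolution.ae_isRegularPoint (hT : 0 < T) (hc : 0 < c)
    (hHU : IsStrongSolution T κ γ G h₀ u₀ H U) (hHc : ∀ z ∈ slab n T, c ≤ H z) :
    ∀ᵐ z ∂(volume.restrict (slab n T)), IsRegularPoint T κ γ G H U z := by
  obtain ⟨K, hK⟩ := hHU.lipschitz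
  filter_upwards [ae_differentiableAt_time hK, ae_all_iff.2 (ae_differentiableAt_space hK),
    hHU.mass, hHU.momentum] with z h1 h2 h3 h4
  have hz : z ∈ slab n T := ⟨Ioo_subset_Icc_self h1.1, mem_univ _⟩
  have hpos : 0 < H z := hc.trans_le (hHc z hz)
  have hUs : ∀ i j, HasDerivAt
      (fun s : ℝ => U (z.1, z.2 + Pi.single j (s : UnitAddCircle)) i) (velGrad U z i j) 0 :=
    fun i j => (hHU.isC1.apply i).hasDerivAt_space hz j
  have hHs : ∀ j, HasDerivAt (fun s : ℝ => H (z.1, z.2 + Pi.single j (s : UnitAddCircle)))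
      (spaceDeriv j H z) 0 := fun j => (h2 j).hasDerivAt
  refine ⟨h1.1, h1.2, h2, ?_, fun i => ?_⟩
  · rw [← h3]
    congr 1
    refine Finset.sum_congr rfl fun j _ => ?_
    have := ((hHs j).mul (hUs j j)).deriv
    simp only [AddCircle.coe_zero, Pi.single_zero, add_zero] at this
    exact this.symm
  · rw [← h4 i]
    congr 1
    · congr 1
      · have hHt : HasDerivWithinAt (fun s => H (s, z.2)) (timeDeriv T H z) (Icc 0 T) z.1 := by
          rw [timeDeriv_eq_deriv _ h1.1]
          exact h1.2.hasDerivAt.hasDerivWithinAt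
        have := (hHt.mul ((hHU.isC1.apply i).hasDerivWithinAt_time hT hz)).derivWithin
          (uniqueDiffOn_Icc hT _ hz.1)
        rw [hHU.isC1.timeDeriv_apply hT hz] at this
        exact this.symm
      · refine Finset.sum_congr rfl fun j _ => ?_
        have := (((hHs j).mul (hUs i j)).mul (hUs j j)).deriv
        simp only [Pi.mul_apply, AddCircle.coe_zero, Pi.single_zero, add_zero] at this
        refine Eq.trans ?_ this.symm
        ring
    · exact (hasDerivAt_space_const_mul_rpow (h2 i) hpos κ γ).deriv.symm

/-- The momentum equation minus `U i` times the mass equation is `H` times the velocity equation,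
and `H z > 0` may be divided out. -/
theorem IsRegularPoint.velocity_eq {z : ℝ × Torus n} (hz : IsRegularPoint T κ γ G H U z)
    (hpos : 0 < H z) (i : Fin n) :
    timeDeriv T U z i = G z i - (∑ j, velGrad U z i j * U z j)
      - κ * γ * H z ^ (γ - 2) * spaceDeriv i H z := by
  have h1 := hz.momentum i
  have h2 := hz.mass
  have h3 : H z ^ (γ - 1) = H z ^ (γ - 2) * H z := by
    rw [← Real.rpow_add_one hpos.ne']
    congr 1
    ring
  have h4 : ∑ j, (spaceDeriv j H z * U z i * U z j + H z * velGrad U z i j * U z j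
        + H z * U z i * velGrad U z j j)
      = U z i * ∑ j, (spaceDeriv j H z * U z j + H z * velGrad U z j j)
        + H z * ∑ j, velGrad U z i j * U z j := by
    rw [Finset.mul_sum, Finset.mul_sum, ← Finset.sum_add_distrib]
    exact Finset.sum_congr rfl fun j _ => by ring
  rw [h4, h3] at h1
  refine mul_left_cancel₀ hpos.ne' ?_
  linear_combination h1 - U z i * h2

/-- The algebra behind the relative energy inequality. -/
theorem relFlux_identity {κ γ h q a p t : ℝ} {u b v g d : Fin n → ℝ} {A M : Fin n → Fin n → ℝ}
    (hq : κ * γ * h ^ (γ - 1) = q * h)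
    (hv : ∀ i, v i = g i - (∑ j, A i j * u j) - q * d i)
    (ht : t + ∑ j, (d j * u j + h * A j j) = 0) :
    (∑ i, g i * b i) - ((∑ i, v i * b i) + (∑ i, ∑ j, A i j * M i j) + κ * ((∑ i, A i i) * p)
        + ∑ i, u i * (a * g i))
      + ((∑ i, u i * v i) * a + ∑ j, (∑ i, u i * A i j) * b j)
      - (q * t * a + ∑ j, q * d j * b j)
      + (q * h * t + ∑ i, (q * h * d i * u i + κ * h ^ γ * A i i))
    = -(∑ i, ∑ j, A i j * (M i j - u j * b i - u i * b j + u i * u j * a))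
        - κ * (∑ i, A i i) * (p - h ^ γ - γ * h ^ (γ - 1) * (a - h)) := by
  -- Here and in `e2` the velocity equation is substituted: `v · b` yields `g · b`, and `u · v`
  -- yields `u · g`, which remove all force terms.
  have e1 : ∑ i, v i * b i
      = (∑ i, g i * b i) - (∑ i, ∑ j, A i j * (u j * b i)) - q * ∑ i, d i * b i := by
    rw [Finset.mul_sum, ← Finset.sum_sub_distrib, ← Finset.sum_sub_distrib]
    refine Finset.sum_congr rfl fun i _ => ?_
    have : ∑ j, A i j * (u j * b i) = (∑ j, A i j * u j) * b i := by
      rw [Finset.sum_mul]; exact Finset.sum_congr rfl fun j _ => by ring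
    rw [hv i, this]; ring
  have e2 : ∑ i, u i * v i
      = (∑ i, u i * g i) - (∑ i, ∑ j, A i j * (u i * u j)) - q * ∑ i, d i * u i := by
    rw [Finset.mul_sum, ← Finset.sum_sub_distrib, ← Finset.sum_sub_distrib]
    refine Finset.sum_congr rfl fun i _ => ?_
    have : ∑ j, A i j * (u i * u j) = u i * ∑ j, A i j * u j := by
      rw [Finset.mul_sum]; exact Finset.sum_congr rfl fun j _ => by ring
    rw [hv i, this]; ring
  have e3 : ∑ j, (∑ i, u i * A i j) * b j = ∑ i, ∑ j, A i j * (u i * b j) := by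
    rw [Finset.sum_comm]
    refine Finset.sum_congr rfl fun j _ => ?_
    rw [Finset.sum_mul]
    exact Finset.sum_congr rfl fun i _ => by ring
  have e4 : ∑ i, u i * (a * g i) = a * ∑ i, u i * g i := by
    rw [Finset.mul_sum]; exact Finset.sum_congr rfl fun i _ => by ring
  have e5 : ∑ i, (q * h * d i * u i + κ * h ^ γ * A i i)
      = q * h * (∑ i, d i * u i) + κ * h ^ γ * ∑ i, A i i := by
    rw [Finset.mul_sum, Finset.mul_sum, ← Finset.sum_add_distrib]
    exact Finset.sum_congr rfl fun i _ => by ring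
  have e6 : ∑ j, (d j * u j + h * A j j) = (∑ i, d i * u i) + h * ∑ i, A i i := by
    rw [Finset.mul_sum, ← Finset.sum_add_distrib]
  have e7 : ∑ j, q * d j * b j = q * ∑ i, d i * b i := by
    rw [Finset.mul_sum]; exact Finset.sum_congr rfl fun i _ => by ring
  have e8 : ∑ i, ∑ j, A i j * (M i j - u j * b i - u i * b j + u i * u j * a)
      = (∑ i, ∑ j, A i j * M i j) - (∑ i, ∑ j, A i j * (u j * b i))
        - (∑ i, ∑ j, A i j * (u i * b j)) + (∑ i, ∑ j, A i j * (u i * u j)) * a := by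
    simp only [Finset.sum_mul, ← Finset.sum_sub_distrib, ← Finset.sum_add_distrib]
    exact Finset.sum_congr rfl fun i _ => Finset.sum_congr rfl fun j _ => by ring
  rw [e6] at ht
  rw [e1, e2, e3, e4, e5, e7, e8]
  -- What remains is `q (h - a)` times the strong mass equation, and the relation between `q` and
  -- the pressure, weighted by the divergence.
  linear_combination (q * (h - a)) * ht - (∑ i, A i i) * (a - h) * hq

end

/-! ### Integrability on the slab -/

section Integrability

variable {T : ℝ}

theorem integrableOn_continuousOn_mul {g f : ℝ × Torus n → ℝ} (hg : ContinuousOn g (slab n T))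
    (hf : IntegrableOn f (slab n T)) : IntegrableOn (fun z => g z * f z) (slab n T) := by
  obtain ⟨C, hC⟩ := (isCompact_slab T).exists_bound_of_continuousOn hg
  refine Integrable.bdd_mul (c := C) hf (hg.aestronglyMeasurable (measurableSet_slab T)) ?_
  filter_upwards [ae_restrict_mem (measurableSet_slab T)] with z hz using hC z hz

theorem integrableOn_continuousOn_inner {g f : ℝ × Torus n → Vec n}
    (hg : ContinuousOn g (slab n T))
    (hf : IntegrableOn f (slab n T)) : IntegrableOn (fun z => inner ℝ (g z) (f z)) (slab n T) := by
  obtain ⟨C, hC⟩ := (isCompact_slab T).exists_bound_of_continuousOn hg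
  refine (hf.norm.const_mul C).mono' ((hg.aestronglyMeasurable (measurableSet_slab T)).inner
    hf.aestronglyMeasurable) ?_
  filter_upwards [ae_restrict_mem (measurableSet_slab T)] with z hz
  refine (norm_inner_le_norm _ _).trans ?_
  gcongr
  exact hC z hz

theorem integrableOn_timeDeriv_mul {g f : ℝ × Torus n → ℝ} {K : ℝ≥0}
    (hg : LipschitzOnWith K g (slab n T)) (hf : IntegrableOn f (slab n T)) :
    IntegrableOn (fun z => timeDeriv T g z * f z) (slab n T) :=
  Integrable.bdd_mul hf (aestronglyMeasurable_timeDeriv hg) (ae_abs_timeDeriv_le hg)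

theorem integrableOn_spaceDeriv_mul {g f : ℝ × Torus n → ℝ} {K : ℝ≥0}
    (hg : LipschitzOnWith K g (slab n T)) (hf : IntegrableOn f (slab n T)) (i : Fin n) :
    IntegrableOn (fun z => spaceDeriv i g z * f z) (slab n T) := by
  refine Integrable.bdd_mul (c := K) hf (aestronglyMeasurable_spaceDeriv hg i) ?_
  filter_upwards [ae_restrict_mem (measurableSet_slab T)] with z hz using abs_spaceDeriv_le hg i hz

theorem integrableOn_timeDeriv {g : ℝ × Torus n → ℝ} {K : ℝ≥0}
    (hg : LipschitzOnWith K g (slab n T)) : IntegrableOn (timeDeriv T g) (slab n T) := by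
  simpa using integrableOn_timeDeriv_mul hg (f := fun _ => 1) (integrable_const _)

theorem continuous_slice {X : Type*} [TopologicalSpace X] {g : ℝ × Torus n → X}
    (hg : ContinuousOn g (slab n T)) {t : ℝ} (ht : t ∈ Icc 0 T) :
    Continuous fun x => g (t, x) :=
  hg.comp_continuous (by fun_prop) fun _ => ⟨ht, mem_univ _⟩

theorem integrable_of_continuous_torus {F : Type*} [NormedAddCommGroup F] {v : Torus n → F}
    (hv : Continuous v) : Integrable v :=
  hv.integrable_of_hasCompactSupport (HasCompactSupport.of_compactSpace v)

/-- Fubini with time as the inner variable, then the fundamental theorem of calculus on each time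
line. -/
theorem integral_timeDeriv_eq_sub {g : ℝ × Torus n → ℝ} {K : ℝ≥0}
    (hg : LipschitzOnWith K g (slab n T)) {t : ℝ} (ht : t ∈ Icc 0 T) :
    ∫ z in slab n t, timeDeriv T g z = ∫ x, (g (t, x) - g (0, x)) := by
  have hint := (integrableOn_timeDeriv hg).mono_set (slab_subset ht.2)
  rw [IntegrableOn, volume_restrict_slab] at hint
  rw [volume_restrict_slab, integral_prod_symm _ hint]
  refine integral_congr_ae (Eventually.of_forall fun x => ?_)
  refine integral_derivWithin_eq_sub (K := K) (u := fun s => g (s, x)) ?_ ht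
  refine LipschitzOnWith.of_dist_le_mul fun s hs s' hs' => ?_
  have := hg.dist_le_mul (s, x) ⟨hs, mem_univ _⟩ (s', x) ⟨hs', mem_univ _⟩
  simpa [Prod.dist_eq] using this

end Integrability

/-! ### Divergences integrate to zero -/

section Divergence

variable {T : ℝ}

theorem setIntegral_spaceDeriv_eq_zero {f : ℝ × Torus n → ℝ} (hf : ContinuousOn f (slab n T))
    (i : Fin n) (C : ℝ)
    (hC : ∀ z ∈ slab n T, ∀ s : ℝ, |f (z.1, z.2 + Pi.single i (s : UnitAddCircle)) - f z| ≤ C * |s|)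
    (hd : ∀ᵐ z ∂(volume.restrict (slab n T)),
      DifferentiableAt ℝ (fun s : ℝ => f (z.1, z.2 + Pi.single i (s : UnitAddCircle))) 0)
    (hint : IntegrableOn (spaceDeriv i f) (slab n T)) {t : ℝ} (ht : t ∈ Icc 0 T) :
    ∫ z in slab n t, spaceDeriv i f z = 0 := by
  rw [setIntegral_slab (hint.mono_set (slab_subset ht.2))]
  rw [volume_restrict_slab] at hd
  have hd' := ae_restrict_of_ae_restrict_of_subset (Icc_subset_Icc_right ht.2)
    (Measure.ae_ae_of_ae_prod hd)
  refine integral_eq_zero_of_ae ?_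
  filter_upwards [hd', ae_restrict_mem measurableSet_Icc] with s hs hsm
  have hsT : s ∈ Icc 0 T := Icc_subset_Icc_right ht.2 hsm
  exact integral_deriv_single_eq_zero (continuous_slice hf hsT) C i
    (fun x r => hC (s, x) ⟨hsT, mem_univ _⟩ r) hs

/-- Mean value inequality along a spatial line: the derivative at parameter `r` is the spatial
derivative at the translated point, bounded by compactness of the slab. -/
theorem IsC1.exists_abs_sub_le {f : ℝ × Torus n → ℝ} (hT : 0 < T) (hf : IsC1 T f) (i : Fin n) :
    ∃ C, ∀ z ∈ slab n T, ∀ s : ℝ,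
      |f (z.1, z.2 + Pi.single i (s : UnitAddCircle)) - f z| ≤ C * |s| := by
  obtain ⟨C, hC⟩ :=
    (isCompact_slab T).exists_bound_of_continuousOn (hf.continuousOn_spaceDeriv hT i)
  refine ⟨C, fun z hz s => ?_⟩
  have hder : ∀ r : ℝ, HasDerivAt (fun s : ℝ => f (z.1, z.2 + Pi.single i (s : UnitAddCircle)))
      (spaceDeriv i f (z.1, z.2 + Pi.single i (r : UnitAddCircle))) r := by
    intro r
    have h := hf.hasDerivAt_space (z := (z.1, z.2 + Pi.single i (r : UnitAddCircle)))
      ⟨hz.1, mem_univ _⟩ i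
    have h0 : r + -r = 0 := by ring
    rw [← h0] at h
    have h2 := h.comp_add_const r (-r)
    refine h2.congr_of_eventuallyEq (Eventually.of_forall fun s => ?_)
    simp only
    rw [add_assoc, ← Pi.single_add, ← AddCircle.coe_add]
    congr 5
    ring
  have h := convex_univ.norm_image_sub_le_of_norm_hasDerivWithin_le (C := C)
    (fun r _ => (hder r).hasDerivWithinAt (s := univ)) (fun r _ => hC _ ⟨hz.1, mem_univ _⟩)
    (mem_univ 0) (mem_univ s)
  simpa using h

/-- The divergence of a Lipschitz function times a `C¹` vector field integrates to zero. -/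
theorem setIntegral_spaceDeriv_mul_eq_zero {f g : ℝ × Torus n → ℝ} {K : ℝ≥0} (hT : 0 < T)
    (hf : LipschitzOnWith K f (slab n T)) (hg : IsC1 T g) (i : Fin n) {t : ℝ} (ht : t ∈ Icc 0 T) :
    IntegrableOn (fun z => spaceDeriv i f z * g z + f z * spaceDeriv i g z) (slab n T) ∧
    ∫ z in slab n t, (spaceDeriv i f z * g z + f z * spaceDeriv i g z) = 0 := by
  have hgi : IntegrableOn g (slab n T) := by
    simpa using integrableOn_continuousOn_mul hg.continuousOn (f := fun _ => 1)
      (integrable_const _)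
  have hgi' : IntegrableOn (spaceDeriv i g) (slab n T) := by
    simpa using integrableOn_continuousOn_mul (hg.continuousOn_spaceDeriv hT i) (f := fun _ => 1)
      (integrable_const _)
  have hint : IntegrableOn (fun z => spaceDeriv i f z * g z + f z * spaceDeriv i g z)
      (slab n T) :=
    (integrableOn_spaceDeriv_mul hf hgi i).add
      (integrableOn_continuousOn_mul hf.continuousOn hgi')
  refine ⟨hint, ?_⟩
  have hder : ∀ᵐ z ∂(volume.restrict (slab n T)), HasDerivAt (fun s : ℝ =>
      f (z.1, z.2 + Pi.single i (s : UnitAddCircle))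
        * g (z.1, z.2 + Pi.single i (s : UnitAddCircle)))
      (spaceDeriv i f z * g z + f z * spaceDeriv i g z) 0 := by
    filter_upwards [ae_differentiableAt_space hf i, ae_restrict_mem (measurableSet_slab T)]
      with z h1 h2
    have h := (hasDerivAt_space_of_differentiableAt h1).mul (hg.hasDerivAt_space h2 i)
    simp only [AddCircle.coe_zero, Pi.single_zero, add_zero] at h
    exact h
  have heq : ∀ᵐ z ∂(volume.restrict (slab n T)),
      spaceDeriv i f z * g z + f z * spaceDeriv i g z = spaceDeriv i (fun y => f y * g y) z :=
    hder.mono fun z hz => hz.deriv.symm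
  rw [integral_congr_ae (ae_restrict_of_ae_restrict_of_subset (slab_subset ht.2) heq)]
  obtain ⟨C, hC⟩ := hg.exists_abs_sub_le hT i
  obtain ⟨Mf, hMf⟩ := (isCompact_slab T).exists_bound_of_continuousOn hf.continuousOn
  obtain ⟨Mg, hMg⟩ := (isCompact_slab T).exists_bound_of_continuousOn hg.continuousOn
  refine setIntegral_spaceDeriv_eq_zero (hf.continuousOn.mul hg.continuousOn) i
    (K * Mg + Mf * C) (fun z hz s => ?_) (hder.mono fun z hz => hz.differentiableAt)
    (hint.congr heq) ht
  set z' : ℝ × Torus n := (z.1, z.2 + Pi.single i (s : UnitAddCircle)) with hz'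
  have hzm : z' ∈ slab n T := ⟨hz.1, mem_univ _⟩
  have h1 : |f z' - f z| ≤ K * |s| := by
    have h := hf.dist_le_mul z' hzm z hz
    rw [Real.dist_eq] at h
    refine h.trans (mul_le_mul_of_nonneg_left ?_ K.coe_nonneg)
    have hd := dist_add_single z.2 i s 0
    simp only [AddCircle.coe_zero, Pi.single_zero, add_zero, sub_zero] at hd
    rw [Prod.dist_eq]
    exact max_le (by simp [hz']) hd
  have h2 : f z' * g z' - f z * g z = (f z' - f z) * g z' + f z * (g z' - g z) := by ring
  rw [Pi.mul_apply, Pi.mul_apply, h2]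
  refine (abs_add_le _ _).trans ?_
  rw [abs_mul, abs_mul]
  have h3 : |g z'| ≤ Mg := hMg z' hzm
  have h4 : |f z| ≤ Mf := hMf z hz
  have h5 := hC z hz s
  calc |f z' - f z| * |g z'| + |f z| * |g z' - g z|
      ≤ (K * |s|) * Mg + Mf * (C * |s|) := by
        gcongr
        exact (abs_nonneg _).trans h4
    _ = (K * Mg + Mf * C) * |s| := by ring

end Divergence

/-! ### Grönwall's lemma, and small facts about integrals and Dirac measures -/

/-- An integral form of Grönwall's lemma for nonnegative monotone functions. -/
theorem eq_zero_of_le_mul_integral {F : ℝ → ℝ} {T C : ℝ} (hC : 0 ≤ C)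
    (hmono : MonotoneOn F (Icc 0 T)) (h0 : ∀ t ∈ Icc 0 T, 0 ≤ F t)
    (hF : ∀ t ∈ Icc 0 T, F t ≤ C * ∫ s in Icc 0 t, F s) {t : ℝ} (ht : t ∈ Icc 0 T) : F t = 0 := by
  have hT : T ∈ Icc 0 T := ⟨ht.1.trans ht.2, le_rfl⟩
  -- Monotonicity gives the start `F t ≤ F T`. Each use of the hypothesis integrates once more, and
  -- `(C t) ^ k / k!` tends to zero.
  have key : ∀ k : ℕ, ∀ t ∈ Icc 0 T, F t ≤ F T * ((C * t) ^ k / k.factorial) := by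
    intro k
    induction k with
    | zero => intro t ht; simpa using hmono ht hT ht.2
    | succ k ih =>
      intro t ht
      have hsub : Icc 0 t ⊆ Icc 0 T := Icc_subset_Icc_right ht.2
      have hint : IntegrableOn F (Icc 0 t) := (hmono.mono hsub).integrableOn_isCompact isCompact_Icc
      have hint2 : IntegrableOn (fun s => F T * ((C * s) ^ k / k.factorial)) (Icc 0 t) :=
        Continuous.integrableOn_Icc (by fun_prop)
      refine (hF t ht).trans ?_
      have h1 := setIntegral_mono_on hint hint2 measurableSet_Icc fun s hs => ih s (hsub hs)
      refine (mul_le_mul_of_nonneg_left h1 hC).trans_eq ?_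
      have h2 : (fun s => F T * ((C * s) ^ k / k.factorial))
          = fun s => (F T * C ^ k / k.factorial) * s ^ k := by
        funext s; rw [mul_pow]; ring
      rw [integral_Icc_eq_integral_Ioc, ← intervalIntegral.integral_of_le ht.1, h2,
        intervalIntegral.integral_const_mul, integral_pow, Nat.factorial_succ, Nat.cast_mul,
        Nat.cast_add, Nat.cast_one]
      have hk : (k.factorial : ℝ) ≠ 0 := by exact_mod_cast k.factorial_ne_zero
      field_simp
      ring
  refine le_antisymm ?_ (h0 t ht)
  have hlim := (FloorSemiring.tendsto_pow_div_factorial_atTop (C * t)).const_mul (F T)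
  rw [mul_zero] at hlim
  exact ge_of_tendsto' hlim fun k => key k t ht

theorem HasInt.congr_ae {α : Type*} [MeasurableSpace α] {μ : Measure α} {f g : α → ℝ} {v : ℝ}
    (hf : HasInt μ f v) (h : g =ᵐ[μ] f) : HasInt μ g v :=
  ⟨hf.1.congr h.symm, by rw [integral_congr_ae h, hf.2]⟩

theorem _root_.MeasureTheory.Integrable.hasInt {α : Type*} [MeasurableSpace α] {μ : Measure α}
    {f : α → ℝ} (hf : Integrable f μ) : HasInt μ f (∫ x, f x ∂μ) := ⟨hf, rfl⟩

/-- The identity is almost everywhere the constant `a`, so the two push-forwards of `μ` agree. -/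
theorem eq_dirac_of_ae_eq {α : Type*} [MeasurableSpace α] {μ : Measure α} [IsProbabilityMeasure μ]
    {a : α} (h : ∀ᵐ x ∂μ, x = a) : μ = Measure.dirac a := by
  have h1 : (id : α → α) =ᵐ[μ] fun _ => a := h
  rw [← Measure.map_id (μ := μ), Measure.map_congr h1, Measure.map_const]
  simp

/-! ### The relative energy inequality -/

section RelativeEnergy

variable {T κ γ c : ℝ} {G : ℝ × Torus n → Vec n} {h₀ : Torus n → ℝ} {u₀ : Torus n → Vec n}
  {H : ℝ × Torus n → ℝ} {U : ℝ × Torus n → Vec n} {Y : GenYoungMeasure n γ T}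

theorem inner_eq_sum (v w : Vec n) : inner ℝ v w = ∑ i, v i * w i := by
  simp [PiLp.inner_apply, mul_comm]

/-- The part of the mean relative energy that is linear in height and momentum. -/
def relEnergyLinear (κ : ℝ) (H : ℝ × Torus n → ℝ) (U : ℝ × Torus n → Vec n)
    (Y : GenYoungMeasure n γ T) (z : ℝ × Torus n) : ℝ :=
  -inner ℝ (U z) (Y.huBar z) + 1 / 2 * ‖U z‖ ^ 2 * Y.hBar z
    - κ * γ / (γ - 1) * H z ^ (γ - 1) * Y.hBar z + κ * H z ^ γ

/-- The mean relative energy. -/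
def relEnergyBar (κ : ℝ) (H : ℝ × Torus n → ℝ) (U : ℝ × Torus n → Vec n)
    (Y : GenYoungMeasure n γ T) (z : ℝ × Torus n) : ℝ :=
  Y.osc (relEnergy κ γ (H z) (U z)) z

/-- The mean production of relative energy. -/
def relFluxBar (κ : ℝ) (H : ℝ × Torus n → ℝ) (U : ℝ × Torus n → Vec n)
    (Y : GenYoungMeasure n γ T) (z : ℝ × Torus n) : ℝ :=
  Y.osc (relFlux κ γ (H z) (U z) (velGrad U z)) z

/-- The production of relative energy by concentrations. -/
def concFlux (κ : ℝ) (U : ℝ × Torus n → Vec n) (Y : GenYoungMeasure n γ T)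
    (z : ℝ × Torus n) : ℝ :=
  -(∑ i, ∑ j, velGrad U z i j * Y.conc (fun l => l.2 i * l.2 j) z)
    - κ * ((∑ i, velGrad U z i i) * Y.conc (fun l => (l.1 : ℝ) ^ γ) z)

/-- Quadratic and pressure moments enter only through the energy. The term free of moments is
`κ/(γ-1) (γ - 1) H^γ = κ H^γ`; the other coefficients become test functions. -/
theorem relEnergyBar_eq (hγ : 1 < γ) {z : ℝ × Torus n} (hz : Y.HasMoments z) (hpos : 0 < H z) :
    relEnergyBar κ H U Y z = Y.osc (energyDensity κ γ) z + relEnergyLinear κ H U Y z := by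
  have h1 := (hasInt_relEnergy (κ := κ) hz.h hz.hu hz.huu hz.pressure (H z) (U z)).2
  have h2 := (hasInt_energyDensity (κ := κ) hz.huu hz.pressure).2
  rw [relEnergyBar, relEnergyLinear, GenYoungMeasure.osc, GenYoungMeasure.osc, h1, h2,
    inner_eq_sum, half_norm_sq_eq]
  have h3 : ∑ i, (Y.huuBar i i z - 2 * U z i * Y.huBar z i + U z i * U z i * Y.hBar z)
      = (∑ i, Y.huuBar i i z) - 2 * (∑ i, U z i * Y.huBar z i)
        + (∑ i, U z i * U z i) * Y.hBar z := by
    rw [Finset.mul_sum, Finset.sum_mul, ← Finset.sum_sub_distrib, ← Finset.sum_add_distrib]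
    exact Finset.sum_congr rfl fun i _ => by ring
  have h4 : H z ^ γ = H z ^ (γ - 1) * H z := by
    rw [← Real.rpow_add_one hpos.ne', sub_add_cancel]
  have h5 : γ - 1 ≠ 0 := by linarith
  rw [h3, h4]
  field_simp
  ring

theorem continuousOn_velGrad (hT : 0 < T) (hU : IsC1 T U) (i j : Fin n) :
    ContinuousOn (fun z => velGrad U z i j) (slab n T) :=
  (hU.apply i).continuousOn_spaceDeriv hT j

theorem exists_velGrad_bound (hT : 0 < T) (hU : IsC1 T U) :
    ∃ L, 0 ≤ L ∧ ∀ z ∈ slab n T, ∀ i j, |velGrad U z i j| ≤ L := by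
  have hc : ContinuousOn (velGrad U) (slab n T) :=
    continuousOn_pi.2 fun i => continuousOn_pi.2 fun j => continuousOn_velGrad hT hU i j
  obtain ⟨L, hL⟩ := (isCompact_slab T).exists_bound_of_continuousOn hc
  refine ⟨max L 0, le_max_right _ _, fun z hz i j => ?_⟩
  exact (norm_le_pi_norm (velGrad U z i) j).trans
    ((norm_le_pi_norm (velGrad U z) i).trans ((hL z hz).trans (le_max_left _ _)))

theorem relFluxBar_le (hκ : 0 < κ) (hγ : 1 < γ) {z : ℝ × Torus n} (hz : Y.HasMoments z)
    (hpos : 0 < H z) {L : ℝ} (hL : 0 ≤ L) (hA : ∀ i j, |velGrad U z i j| ≤ L) :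
    relFluxBar κ H U Y z ≤ (2 * n ^ 2 * L + n * L * (γ - 1)) * relEnergyBar κ H U Y z := by
  have h1 := (hasInt_relEnergy (κ := κ) hz.h hz.hu hz.huu hz.pressure (H z) (U z)).1.hasInt
  have h2 := (hasInt_relFlux (κ := κ) hz.h hz.hu hz.huu hz.pressure (H z) (U z)
    (velGrad U z)).1.hasInt
  have h3 := h1.const_mul (2 * n ^ 2 * L + n * L * (γ - 1))
  rw [relFluxBar, relEnergyBar, GenYoungMeasure.osc, GenYoungMeasure.osc, ← h3.2]
  exact integral_mono h2.1 h3.1 fun l => relFlux_le hκ hγ hpos.le hA hL l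

/-- The pointwise identity between the weak formulations and the production term. -/
theorem relFluxBar_eq (hγ : 1 < γ) (hT : 0 < T) (hU : IsC1 T U) {z : ℝ × Torus n}
    (hz : Y.HasMoments z)
    (hr : IsRegularPoint T κ γ G H U z) (hpos : 0 < H z) :
    relFluxBar κ H U Y z = Y.hGuBar G z
      - (inner ℝ (timeDeriv T U z) (Y.huBar z)
          + (∑ i, ∑ j, velGrad U z i j * Y.huuBar i j z)
          + κ * ((∑ i, velGrad U z i i) * Y.hpBar z) + inner ℝ (U z) (Y.hGBar G z))
      + (timeDeriv T (fun y => 1 / 2 * ‖U y‖ ^ 2) z * Y.hBar z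
          + ∑ j, spaceDeriv j (fun y => 1 / 2 * ‖U y‖ ^ 2) z * Y.huBar z j)
      - (timeDeriv T (fun y => κ * γ / (γ - 1) * H y ^ (γ - 1)) z * Y.hBar z
          + ∑ j, spaceDeriv j (fun y => κ * γ / (γ - 1) * H y ^ (γ - 1)) z * Y.huBar z j)
      + (timeDeriv T (fun y => κ * H y ^ γ) z
        + ∑ i, (spaceDeriv i (fun y => κ * H y ^ γ) z * U z i
            + κ * H z ^ γ * spaceDeriv i (fun y => U y i) z)) := by
  have hmem := hr.mem_slab
  have h5 : γ - 1 ≠ 0 := by linarith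
  have h1 := (hasInt_relFlux (κ := κ) hz.h hz.hu hz.huu hz.pressure (H z) (U z) (velGrad U z)).2
  have hrp : H z ^ (γ - 1) = H z ^ (γ - 2) * H z := by
    rw [← Real.rpow_add_one hpos.ne']
    congr 1
    ring
  have e2 : γ - 1 - 1 = γ - 2 := by ring
  -- The choice `q = κ γ H^(γ-2)` makes `q ∂H` the derivative of `κγ/(γ-1) H^(γ-1)` and `q H ∂H`
  -- that of `κ H^γ`.
  have h2 := relFlux_identity (κ := κ) (γ := γ) (h := H z) (q := κ * γ * H z ^ (γ - 2))
    (a := Y.hBar z) (p := Y.hpBar z) (t := timeDeriv T H z) (u := fun i => U z i)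
    (b := fun i => Y.huBar z i) (v := fun i => timeDeriv T U z i) (g := fun i => G z i)
    (d := fun i => spaceDeriv i H z) (A := velGrad U z) (M := fun i j => Y.huuBar i j z)
    (by rw [hrp]; ring) (hr.velocity_eq hpos) hr.mass
  rw [relFluxBar, GenYoungMeasure.osc, h1, ← h2]
  have hPt : timeDeriv T (fun y => κ * γ / (γ - 1) * H y ^ (γ - 1)) z
      = κ * γ * H z ^ (γ - 2) * timeDeriv T H z := by
    rw [timeDeriv_const_mul_rpow hr.mem hr.time hpos, e2]
    field_simp
  have hPx : ∀ j, spaceDeriv j (fun y => κ * γ / (γ - 1) * H y ^ (γ - 1)) z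
      = κ * γ * H z ^ (γ - 2) * spaceDeriv j H z := by
    intro j
    refine (hasDerivAt_space_const_mul_rpow (hr.space j) hpos _ _).deriv.trans ?_
    rw [e2]
    field_simp
  have hpt : timeDeriv T (fun y => κ * H y ^ γ) z
      = κ * γ * H z ^ (γ - 2) * H z * timeDeriv T H z := by
    rw [timeDeriv_const_mul_rpow hr.mem hr.time hpos, hrp]
    ring
  have hpx : ∀ j, spaceDeriv j (fun y => κ * H y ^ γ) z
      = κ * γ * H z ^ (γ - 2) * H z * spaceDeriv j H z := by
    intro j
    refine (hasDerivAt_space_const_mul_rpow (hr.space j) hpos _ _).deriv.trans ?_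
    rw [hrp]
    ring
  rw [hPt, hpt, hz.hG, hz.power, hU.timeDeriv_half_norm_sq hT hmem]
  simp only [hPx, hpx, hU.spaceDeriv_half_norm_sq hmem, inner_eq_sum, PiLp.smul_apply, smul_eq_mul,
    velGrad]

/-- The four weak formulations tested with the strong solution combine to an identity for
the growth of the relative energy. -/
theorem relEnergy_growth_eq (hT : 0 < T) (hγ : 1 < γ) (hc : 0 < c)
    (hHU : IsStrongSolution T κ γ G h₀ u₀ H U) (hHc : ∀ z ∈ slab n T, c ≤ H z)
    (hY : Y.IsSolution κ G h₀ u₀) (hadm : Y.IsAdmissible κ G h₀ u₀) :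
    IntegrableOn (relFluxBar κ H U Y) (slab n T) ∧ IntegrableOn (concFlux κ U Y) (slab n T) Y.m ∧
    IntegrableOn (relEnergyLinear κ H U Y) (slab n T) ∧
    ∀ᵐ t ∂(volume.restrict (Icc (0 : ℝ) T)),
      initialEnergy κ γ h₀ u₀ + (∫ z in slab n t, Y.hGuBar G z)
          + ∫ x, relEnergyLinear κ H U Y (t, x)
        = (∫ z in slab n t, relFluxBar κ H U Y z) + ∫ z in slab n t, concFlux κ U Y z ∂Y.m := by
  obtain ⟨K, hK⟩ := hHU.lipschitz
  have hU := hHU.isC1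
  obtain ⟨M, hM⟩ := (isCompact_slab T).exists_bound_of_continuousOn hK.continuousOn
  have hmaps : MapsTo H (slab n T) (Icc c M) := fun z hz => ⟨hHc z hz, (le_abs_self _).trans (hM z hz)⟩
  have hposH : ∀ z ∈ slab n T, 0 < H z := fun z hz => hc.trans_le (hHc z hz)
  obtain ⟨K1, hK1⟩ := exists_lipschitzOnWith_rpow hc hmaps hK (γ - 1)
  obtain ⟨K2, hK2⟩ := exists_lipschitzOnWith_rpow hc hmaps hK γ
  have hP := lipschitzOnWith_const_mul hK1 (κ * γ / (γ - 1))
  have hp := lipschitzOnWith_const_mul hK2 κ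
  have hh := hY.integrableOn_hBar
  have hhu := hY.integrableOn_huBar
  have hn2 := hU.half_norm_sq
  -- integrability of the terms on the slab
  have i1 : IntegrableOn (fun z => inner ℝ (timeDeriv T U z) (Y.huBar z)) (slab n T) :=
    integrableOn_continuousOn_inner (hU.continuousOn_timeDeriv hT) hhu
  have i2 : ∀ i j, IntegrableOn (fun z => velGrad U z i j * Y.huuBar i j z) (slab n T) :=
    fun i j => integrableOn_continuousOn_mul (continuousOn_velGrad hT hU i j)
      (hY.integrableOn_huuBar i j)
  have hdiv : ContinuousOn (fun z => ∑ i, velGrad U z i i) (slab n T) :=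
    continuousOn_finsetSum _ fun i _ => continuousOn_velGrad hT hU i i
  have i3 : IntegrableOn (fun z => (∑ i, velGrad U z i i) * Y.hpBar z) (slab n T) :=
    integrableOn_continuousOn_mul hdiv hY.integrableOn_hpBar
  have i4 : IntegrableOn (fun z => inner ℝ (U z) (Y.hGBar G z)) (slab n T) :=
    integrableOn_continuousOn_inner hU.continuousOn hY.integrable_hG.2
  have i5 : IntegrableOn (fun z => timeDeriv T (fun y => 1 / 2 * ‖U y‖ ^ 2) z * Y.hBar z
      + ∑ j, spaceDeriv j (fun y => 1 / 2 * ‖U y‖ ^ 2) z * Y.huBar z j) (slab n T) :=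
    (integrableOn_continuousOn_mul (hn2.continuousOn_timeDeriv hT) hh).add
      (integrable_finsetSum _ fun j _ => integrableOn_continuousOn_mul
        (hn2.continuousOn_spaceDeriv hT j) (integrable_apply hhu j))
  have i6 : IntegrableOn (fun z =>
      timeDeriv T (fun y => κ * γ / (γ - 1) * H y ^ (γ - 1)) z * Y.hBar z
      + ∑ j, spaceDeriv j (fun y => κ * γ / (γ - 1) * H y ^ (γ - 1)) z * Y.huBar z j)
      (slab n T) :=
    (integrableOn_timeDeriv_mul hP hh).add
      (integrable_finsetSum _ fun j _ => integrableOn_spaceDeriv_mul hP (integrable_apply hhu j) j)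
  have i7 := integrableOn_timeDeriv hp
  have i8 := hadm.integrable_power.2
  have hsum : ∀ t ∈ Icc 0 T, HasInt (volume.restrict (slab n t)) (relFluxBar κ H U Y)
      ((∫ z in slab n t, Y.hGuBar G z)
        - ((∫ z in slab n t, inner ℝ (timeDeriv T U z) (Y.huBar z))
          + (∑ i, ∑ j, ∫ z in slab n t, velGrad U z i j * Y.huuBar i j z)
          + κ * (∫ z in slab n t, (∑ i, velGrad U z i i) * Y.hpBar z)
          + ∫ z in slab n t, inner ℝ (U z) (Y.hGBar G z))
        + (∫ z in slab n t, (timeDeriv T (fun y => 1 / 2 * ‖U y‖ ^ 2) z * Y.hBar z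
          + ∑ j, spaceDeriv j (fun y => 1 / 2 * ‖U y‖ ^ 2) z * Y.huBar z j))
        - (∫ z in slab n t, (timeDeriv T (fun y => κ * γ / (γ - 1) * H y ^ (γ - 1)) z * Y.hBar z
          + ∑ j, spaceDeriv j (fun y => κ * γ / (γ - 1) * H y ^ (γ - 1)) z * Y.huBar z j))
        + ((∫ z in slab n t, timeDeriv T (fun y => κ * H y ^ γ) z) + ∑ _i : Fin n, 0)) := by
    intro t ht
    have hsub : slab n t ⊆ slab n T := slab_subset ht.2
    have hrest : ∀ {f : ℝ × Torus n → ℝ}, IntegrableOn f (slab n T) →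
        HasInt (volume.restrict (slab n t)) f (∫ z in slab n t, f z) := fun hf =>
      (hf.mono_set hsub).hasInt
    have hzero : ∀ i, HasInt (volume.restrict (slab n t)) (fun z =>
        spaceDeriv i (fun y => κ * H y ^ γ) z * U z i
          + κ * H z ^ γ * spaceDeriv i (fun y => U y i) z) 0 := fun i =>
      have h := setIntegral_spaceDeriv_mul_eq_zero hT hp (hU.apply i) i ht
      ⟨h.1.mono_set hsub, h.2⟩
    refine HasInt.congr_ae (((((hrest i8).sub ((((hrest i1).add (HasInt.sum fun i =>
      HasInt.sum fun j => hrest (i2 i j))).add ((hrest i3).const_mul κ)).add (hrest i4))).add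
      (hrest i5)).sub (hrest i6)).add ((hrest i7).add (HasInt.sum hzero))) ?_
    refine ae_restrict_of_ae_restrict_of_subset hsub ?_
    filter_upwards [hY.ae_hasMoments, hHU.ae_isRegularPoint hT hc hHc] with z h1 h2
    exact relFluxBar_eq hγ hT hU h1 h2 (hposH z h2.mem_slab)
  have hconc : ∀ t ∈ Icc 0 T, HasInt (Y.m.restrict (slab n t)) (concFlux κ U Y)
      (-(∑ i, ∑ j, ∫ z in slab n t, velGrad U z i j * Y.conc (fun l => l.2 i * l.2 j) z ∂Y.m)
        - κ * ∫ z in slab n t,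
            (∑ i, velGrad U z i i) * Y.conc (fun l => (l.1 : ℝ) ^ γ) z ∂Y.m) := by
    intro t ht
    have hsub : slab n t ⊆ slab n T := slab_subset ht.2
    exact (HasInt.sum fun i => HasInt.sum fun j =>
      (Y.integrableOn_mul_conc hγ (continuous_velocity_mul i j) hsub (measurableSet_slab t)
        (continuousOn_velGrad hT hU i j)).hasInt).neg.sub
      ((Y.integrableOn_mul_conc hγ (continuous_height_rpow (by linarith)) hsub
        (measurableSet_slab t) hdiv).hasInt.const_mul κ)
  have hTT : T ∈ Icc 0 T := ⟨hT.le, le_rfl⟩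
  have hT0 : (0 : ℝ) ∈ Icc 0 T := ⟨le_rfl, hT.le⟩
  have hlin : IntegrableOn (relEnergyLinear κ H U Y) (slab n T) := by
    refine (((integrableOn_continuousOn_inner hU.continuousOn hhu).neg.add
      (integrableOn_continuousOn_mul hn2.continuousOn hh)).sub
      (integrableOn_continuousOn_mul hP.continuousOn hh)).add ?_
    simpa using integrableOn_continuousOn_mul hp.continuousOn (f := fun _ => 1)
      (integrable_const _)
  refine ⟨(hsum T hTT).1, (hconc T hTT).1, hlin, ?_⟩
  filter_upwards [hY.momentum U hU, hY.mass _ hn2, hY.mass_of_lipschitz hP,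
    ae_integrable_slice hh, ae_integrable_slice hhu, ae_restrict_mem measurableSet_Icc]
    with t hmom hm1 hm2 hsh hshu ht
  -- the terms on time slices
  have cU : ∀ s ∈ Icc 0 T, Continuous fun x => U (s, x) := fun s hs =>
    continuous_slice hU.continuousOn hs
  have cN : ∀ s ∈ Icc 0 T, Continuous fun x => 1 / 2 * ‖U (s, x)‖ ^ 2 := fun s hs =>
    continuous_slice hn2.continuousOn hs
  have cP : ∀ s ∈ Icc 0 T, Continuous fun x => κ * γ / (γ - 1) * H (s, x) ^ (γ - 1) :=
    fun s hs => continuous_slice hP.continuousOn hs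
  have cp : ∀ s ∈ Icc 0 T, Continuous fun x => κ * H (s, x) ^ γ := fun s hs =>
    continuous_slice hp.continuousOn hs
  have bmul : ∀ {f g : Torus n → ℝ}, Continuous f → Integrable g →
      Integrable fun x => f x * g x := fun {f g} hf hg => by
    obtain ⟨C, hC⟩ := isCompact_univ.exists_bound_of_continuousOn hf.continuousOn
    exact Integrable.bdd_mul hg hf.aestronglyMeasurable
      (Eventually.of_forall fun x => hC x (mem_univ x))
  have binner : ∀ {f g : Torus n → Vec n}, Continuous f → Integrable g →
      Integrable fun x => (inner ℝ (f x) (g x) : ℝ) := fun {f g} hf hg => by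
    simp only [inner_eq_sum]
    exact integrable_finsetSum _ fun i _ => bmul (by fun_prop) (integrable_apply hg i)
  have s1 := (binner (cU t ht) hshu).hasInt
  have s2 := (bmul (cN t ht) hsh).hasInt
  have s3 := (bmul (cP t ht) hsh).hasInt
  have s4 := (integrable_of_continuous_torus (cp t ht)).hasInt
  have s40 := (integrable_of_continuous_torus (cp 0 hT0)).hasInt
  have s5 := (binner (cU 0 hT0) hY.integrable_h₀u₀).hasInt
  have s6 := (bmul (cN 0 hT0) hY.integrable_h₀).hasInt
  have s7 := (bmul (cP 0 hT0) hY.integrable_h₀).hasInt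
  -- The initial relative energy is zero: the initial energy density is minus the affine part
  -- evaluated at the initial data.
  have hpt : ∀ᵐ x : Torus n,
      1 / 2 * (h₀ x * ‖u₀ x‖ ^ 2) + κ / (γ - 1) * h₀ x ^ γ
        = inner ℝ (U (0, x)) (h₀ x • u₀ x) - 1 / 2 * ‖U (0, x)‖ ^ 2 * h₀ x
          + κ * γ / (γ - 1) * H (0, x) ^ (γ - 1) * h₀ x - κ * H (0, x) ^ γ := by
    filter_upwards [hHU.initial_height, hHU.initial_velocity] with x h1 h2
    have hpos : 0 < h₀ x := h1 ▸ hposH _ ⟨hT0, mem_univ _⟩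
    have h4 : h₀ x ^ γ = h₀ x ^ (γ - 1) * h₀ x := by
      rw [← Real.rpow_add_one hpos.ne', sub_add_cancel]
    have h5 : γ - 1 ≠ 0 := by linarith
    rw [h1, h2, inner_smul_right, real_inner_self_eq_norm_sq, h4]
    field_simp
    ring
  have sE : HasInt volume (fun x => 1 / 2 * (h₀ x * ‖u₀ x‖ ^ 2) + κ / (γ - 1) * h₀ x ^ γ) _ :=
    (((s5.sub s6).add s7).sub s40).congr_ae hpt
  have hE : initialEnergy κ γ h₀ u₀ = _ := sE.2
  have hlinT : HasInt volume (fun x => relEnergyLinear κ H U Y (t, x)) _ :=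
    ((s1.neg.add s2).sub s3).add s4
  have hmom' := (s5.sub s1).2
  have hm1' := (s6.sub s2).2
  have hm2' := (s7.sub s3).2
  have hpt' := (s4.sub s40).2
  have hdt := integral_timeDeriv_eq_sub hp ht
  rw [hpt'] at hdt
  rw [hmom'] at hmom
  rw [hm1'] at hm1
  rw [hm2'] at hm2
  rw [(hsum t ht).2, (hconc t ht).2, hlinT.2, hE, hdt]
  simp only [GenYoungMeasure.pairing, Finset.sum_add_distrib, Finset.sum_const_zero] at hmom ⊢
  simp only [velGrad, GenYoungMeasure.huuBar, GenYoungMeasure.hpBar]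
  -- The signs are opposite to those of `U`, `κγ/(γ-1) H^(γ-1)` and `|U|²/2` as coefficients in
  -- `relEnergyLinear`.
  linear_combination hmom + hm2 - hm1

end RelativeEnergy

/-! ### Grönwall estimate for the total relative energy -/

section Uniqueness

variable {T κ γ c : ℝ} {G : ℝ × Torus n → Vec n} {h₀ : Torus n → ℝ} {u₀ : Torus n → Vec n}
  {H : ℝ × Torus n → ℝ} {U : ℝ × Torus n → Vec n} {Y : GenYoungMeasure n γ T}

/-- The total relative energy in `[0, t] × 𝕋ⁿ`, concentrations included. -/
def totalRelEnergy (κ : ℝ) (H : ℝ × Torus n → ℝ) (U : ℝ × Torus n → Vec n)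
    (Y : GenYoungMeasure n γ T) (t : ℝ) : ℝ :=
  (∫ z in slab n t, relEnergyBar κ H U Y z) + ∫ z in slab n t, Y.conc (energyDensity κ γ) z ∂Y.m

theorem relEnergyBar_nonneg (hκ : 0 < κ) (hγ : 1 < γ) {z : ℝ × Torus n} (hpos : 0 < H z) :
    0 ≤ relEnergyBar κ H U Y z :=
  integral_nonneg fun l => relEnergy_nonneg hκ hγ hpos.le l

/-- The slab form of the energy inequality bounds the relative energy of `[0, τ]` by the time
integral of the growth identity, whose right side at time `t` is at most `C` times the relative
energy of `[0, t]`. Grönwall's lemma concludes. -/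
theorem totalRelEnergy_eq_zero (hT : 0 < T) (hκ : 0 < κ) (hγ : 1 < γ) (hc : 0 < c)
    (hHU : IsStrongSolution T κ γ G h₀ u₀ H U) (hHc : ∀ z ∈ slab n T, c ≤ H z)
    (hY : Y.IsSolution κ G h₀ u₀) (hadm : Y.IsAdmissible κ G h₀ u₀) :
    IntegrableOn (relEnergyBar κ H U Y) (slab n T) ∧ totalRelEnergy κ H U Y T = 0 := by
  obtain ⟨hflux, hcflux, hlin, hgrowth⟩ := relEnergy_growth_eq hT hγ hc hHU hHc hY hadm
  obtain ⟨L, hL, hA⟩ := exists_velGrad_bound hT hHU.isC1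
  have hposH : ∀ z ∈ slab n T, 0 < H z := fun z hz => hc.trans_le (hHc z hz)
  have heq : ∀ᵐ z ∂(volume.restrict (slab n T)),
      relEnergyBar κ H U Y z = Y.osc (energyDensity κ γ) z + relEnergyLinear κ H U Y z := by
    filter_upwards [hY.ae_hasMoments, ae_restrict_mem (measurableSet_slab T)] with z h1 h2
    exact relEnergyBar_eq hγ h1 (hposH z h2)
  have hosc := hY.integrableOn_osc_energyDensity
  have hrel : IntegrableOn (relEnergyBar κ H U Y) (slab n T) :=
    (hosc.add hlin).congr (heq.mono fun z hz => hz.symm)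
  refine ⟨hrel, ?_⟩
  have hconc : Integrable (Y.conc (energyDensity κ γ)) Y.m :=
    Y.integrable_conc hγ (continuous_energyDensity hγ)
  have hconc0 : ∀ z, 0 ≤ Y.conc (energyDensity κ γ) z := fun z =>
    (Y.conc_energyDensity_pos hκ hγ z).le
  have hrel0 : ∀ z ∈ slab n T, 0 ≤ relEnergyBar κ H U Y z := fun z hz =>
    relEnergyBar_nonneg hκ hγ (hposH z hz)
  have hmono : MonotoneOn (totalRelEnergy κ H U Y) (Icc 0 T) := by
    intro s hs t ht hst
    have hsub : slab n t ⊆ slab n T := slab_subset ht.2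
    refine add_le_add (setIntegral_mono_set (hrel.mono_set hsub) ?_
      (slab_subset hst).eventuallyLE) (setIntegral_mono_set hconc.integrableOn
        (Eventually.of_forall hconc0) (slab_subset hst).eventuallyLE)
    filter_upwards [ae_restrict_mem (measurableSet_slab t)] with z hz using hrel0 z (hsub hz)
  have hnonneg : ∀ t ∈ Icc 0 T, 0 ≤ totalRelEnergy κ H U Y t := fun t ht =>
    add_nonneg (setIntegral_nonneg (measurableSet_slab t) fun z hz =>
      hrel0 z (slab_subset ht.2 hz)) (integral_nonneg hconc0)
  set C : ℝ := 2 * n ^ 2 * L + n * L * (γ - 1) with hCdef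
  have hC : 0 ≤ C := by
    have : 0 ≤ γ - 1 := by linarith
    positivity
  refine eq_zero_of_le_mul_integral hC hmono hnonneg (fun τ hτ => ?_) ⟨hT.le, le_rfl⟩
  have hsub : slab n τ ⊆ slab n T := slab_subset hτ.2
  have hIsub : Icc 0 τ ⊆ Icc 0 T := Icc_subset_Icc_right hτ.2
  have h1 : totalRelEnergy κ H U Y τ = ((∫ z in slab n τ, Y.osc (energyDensity κ γ) z)
      + ∫ z in slab n τ, Y.conc (energyDensity κ γ) z ∂Y.m)
      + ∫ t in Icc 0 τ, ∫ x, relEnergyLinear κ H U Y (t, x) := by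
    rw [totalRelEnergy, integral_congr_ae (ae_restrict_of_ae_restrict_of_subset hsub heq),
      integral_add (hosc.mono_set hsub) (hlin.mono_set hsub), setIntegral_slab
      (hlin.mono_set hsub)]
    ring
  have hint1 : IntegrableOn
      (fun t => initialEnergy κ γ h₀ u₀ + ∫ z in slab n t, Y.hGuBar G z) (Icc 0 τ) :=
    ((continuousOn_const.add
      (continuousOn_setIntegral_slab hadm.integrable_power.2)).integrableOn_Icc).mono_set hIsub
  have hint2 := integrableOn_integral_slice (hlin.mono_set hsub)
  have hint3 : IntegrableOn (totalRelEnergy κ H U Y) (Icc 0 τ) :=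
    (hmono.mono hIsub).integrableOn_isCompact isCompact_Icc
  rw [h1]
  refine (add_le_add_left (hadm.energy_slab_le hγ hY hτ) _).trans ?_
  rw [← integral_add hint1 hint2, ← integral_const_mul]
  refine integral_mono_ae (hint1.add hint2) (hint3.const_mul C) ?_
  -- The growth identity holds for almost every `t` only, which suffices under the time integral.
  filter_upwards [ae_restrict_of_ae_restrict_of_subset hIsub hgrowth,
    ae_restrict_mem measurableSet_Icc] with t ht htm
  have hsubt : slab n t ⊆ slab n T := slab_subset (htm.2.trans hτ.2)
  rw [ht, totalRelEnergy, mul_add, ← integral_const_mul, ← integral_const_mul]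
  refine add_le_add ?_ ?_
  · refine integral_mono_ae (hflux.mono_set hsubt) ((hrel.mono_set hsubt).const_mul C) ?_
    refine ae_restrict_of_ae_restrict_of_subset hsubt ?_
    filter_upwards [hY.ae_hasMoments, ae_restrict_mem (measurableSet_slab T)] with z hz hzm
    exact relFluxBar_le hκ hγ hz (hposH z hzm) hL (hA z hzm)
  · refine setIntegral_mono_on (hcflux.mono_set hsubt) (hconc.integrableOn.const_mul C)
      (measurableSet_slab t) fun z hz => ?_
    exact Y.conc_flux_le hκ hγ (hA z (hsubt hz)) hL z

end Uniqueness

end EulerMV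

end

/-! ### Conclusion: zero relative energy identifies `ν` and `m` -/

open EulerMV in
theorem theorem4p1 {n : ℕ} (hn : 1 ≤ n) {T κ γ c : ℝ} (hT : 0 < T) (hκ : 0 < κ) (hγ : 1 < γ)
    (hc : 0 < c)
    (G : ℝ × Torus n → Vec n) (hG : IsLinftyL2 T G)
    (h₀ : Torus n → ℝ) (u₀ : Torus n → Vec n)
    (hh₀ : ∀ᵐ x : Torus n, c ≤ h₀ x)
    (hh₀_mem : MemLp h₀ (ENNReal.ofReal γ) volume)
    (hu₀ : Integrable fun x : Torus n => h₀ x * ‖u₀ x‖ ^ 2)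
    (H : ℝ × Torus n → ℝ) (U : ℝ × Torus n → Vec n)
    (hHU : IsStrongSolution T κ γ G h₀ u₀ H U)
    (hHc : ∀ z ∈ slab n T, c ≤ H z)
    (Y : GenYoungMeasure n γ T)
    (hY : Y.IsSolution κ G h₀ u₀)
    (hYadm : Y.IsAdmissible κ G h₀ u₀) :
    (∀ᵐ z ∂(volume.restrict (slab n T)),
      (Y.ν z : Measure (State n)) = Measure.dirac ((H z).toNNReal, √(H z) • U z)) ∧
    Y.m = 0 := by
  obtain ⟨hrel, hzero⟩ := totalRelEnergy_eq_zero hT hκ hγ hc hHU hHc hY hYadm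
  have hposH : ∀ z ∈ slab n T, 0 < H z := fun z hz => hc.trans_le (hHc z hz)
  have hrel0 : ∀ᵐ z ∂(volume.restrict (slab n T)), 0 ≤ relEnergyBar κ H U Y z := by
    filter_upwards [ae_restrict_mem (measurableSet_slab T)] with z hz
    exact relEnergyBar_nonneg hκ hγ (hposH z hz)
  have hconc : Integrable (Y.conc (energyDensity κ γ)) Y.m :=
    Y.integrable_conc hγ (continuous_energyDensity hγ)
  have hconc0 : ∀ z, 0 < Y.conc (energyDensity κ γ) z := fun z =>
    Y.conc_energyDensity_pos hκ hγ z
  have hA : 0 ≤ ∫ z in slab n T, relEnergyBar κ H U Y z := integral_nonneg_of_ae hrel0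
  have hB : 0 ≤ ∫ z in slab n T, Y.conc (energyDensity κ γ) z ∂Y.m :=
    integral_nonneg fun z => (hconc0 z).le
  rw [totalRelEnergy] at hzero
  constructor
  · have h1 := (integral_eq_zero_iff_of_nonneg_ae hrel0 hrel).1 (by linarith)
    filter_upwards [h1, hY.ae_hasMoments, ae_restrict_mem (measurableSet_slab T)] with z hz hm hzm
    have hpos := hposH z hzm
    have hint := (hasInt_relEnergy (κ := κ) hm.h hm.hu hm.huu hm.pressure (H z) (U z)).1
    have h2 := (integral_eq_zero_iff_of_nonneg
      (fun l => relEnergy_nonneg hκ hγ hpos.le l) hint).1 hz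
    exact eq_dirac_of_ae_eq (h2.mono fun l hl => eq_of_relEnergy_eq_zero hκ hγ hpos hl)
  · have h1 := (integral_eq_zero_iff_of_nonneg (fun z => (hconc0 z).le)
      hconc.integrableOn).1 (by linarith)
    -- A strictly positive function that vanishes almost everywhere leaves no room for mass of `m`
    -- in the slab.
    have h2 : ∀ᵐ z ∂Y.m.restrict (slab n T), False := h1.mono fun z hz => (hconc0 z).ne' hz
    have h3 : Y.m.restrict (slab n T) = 0 := ae_eq_bot.1 (Filter.eventually_false_iff_eq_bot.1 h2)
    have h4 : Y.m (slab n T) = 0 := Measure.restrict_eq_zero.1 h3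
    rw [← Measure.measure_univ_eq_zero, ← union_compl_self (slab n T)]
    exact measure_union_null h4 Y.concentrated
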